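/- Let $\gamma,\gamma_1,\gamma_2,\delta_1,\delta_2\in\mathbb R$ with $\gamma_1,\delta_1>0$, and consider the Cauchy problem for the fifth order KdV--BBM equation for real-valued $\eta=\eta(x,t)$, $$\partial_t\eta+\partial_x\eta-\gamma_1\partial_t\partial_x^2\eta+\gamma_2\partial_x^3\eta+\delta_1\partial_t\partial_x^4\eta+\delta_2\partial_x^5\eta=-\tfrac34\partial_x(\eta^2)-\gamma\,\partial_x^3(\eta^2)+\tfrac7{48}\partial_x(\eta_x^2)+\tfrac18\partial_x(\eta^3),\qquad \eta(x,0)=\eta_0(x).$$ With $\widehat f(\xi)=\int_{\mathbb R} e^{-ix\xi}f(x)\,dx$ and $\langle\xi\rangle=\sqrt{1+\xi^2}$, let $H^{\sigma,2}(\mathbb R)$ be the space of real-valued $f\in L^2(\mathbb R)$ with $\|f\|_{H^{\sigma,2}}:=\|\cosh(\sigma|\xi|)\langle\xi\rangle^2\widehat f\|_{L^2_\xi}<\infty$. Put $D=-i\partial_x$, $\varphi(\xi)=1+\gamma_1\xi^2+\delta_1\xi^4$, $$\phi(\xi)=\frac{\xi(1-\gamma_2\xi^2+\delta_2\xi^4)}{\varphi(\xi)},\quad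 \tau(\xi)=\frac{\xi(3-4\gamma\xi^2)}{4\varphi(\xi)},\quad \psi(\xi)=\frac{\xi}{\varphi(\xi)},\quad F(\eta)=\tau(D)\eta^2-\tfrac7{48}\psi(D)\eta_x^2-\tfrac18\psi(D)\eta^3 .$$ A mild solution on $[0,T]$ with datum $\eta_0\in H^{\sigma,2}(\mathbb R)$ is an $\eta\in C([0,T];H^{\sigma,2}(\mathbb R))$ such that, for all $t\in[0,T]$, $$\eta(t)=e^{-it\phi(D)}\eta_0-i\int_0^t e^{-i(t-s)\phi(D)}F(\eta(s))\,ds .$$ **Theorem (local well-posedness).** There is a constant $c>0$, depending only on $\gamma,\gamma_1,\gamma_2,\delta_1,\delta_2$, such that the following holds for every $\sigma_0>0$ and every $\eta_0\in H^{\sigma_0,2}(\mathbb R)$. Let $$T=c\,\bigl(1+\|\eta_0\|_{H^{\sigma_0,2}(\mathbb R)}\bigr)^{-2}.$$ Then there is a unique mild solution $\eta\in C([0,T];H^{\sigma_0,2}(\mathbb R))$ with datum $\eta_0$. Moreover, the data-to-solution map is continuous: there is an open set $U\subseteq H^{\sigma_0,2}(\mathbb R)$ containing all $u_0$ with $\|u_0\|_{H^{\sigma_0,2}}\le\|\eta_0\|_{H^{\sigma_0,2}}$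 (in particular $\eta_0$) such that each $u_0\in U$ has a unique mild solution in $C([0,T];H^{\sigma_0,2}(\mathbb R))$, and the map $u_0\mapsto u$ from $U$ to $C([0,T];H^{\sigma_0,2}(\mathbb R))$ (with the supremum norm) is continuous. -/

import Mathlib

open MeasureTheory FourierTransform Set

noncomputable section

namespace KdVBBM

/-- The inclusion `L²(ℝ; ℝ) → L²(ℝ; ℂ)`. -/
def toComplex (f : Lp ℝ 2 (volume : Measure ℝ)) : Lp ℂ 2 (volume : Measure ℝ) :=
  Complex.ofRealCLM.compLp f

/-- The (Plancherel) Fourier transform of a real-valued `f ∈ L²(ℝ)`, in the normalization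
`f̂(ξ) = ∫ e^{-ixξ} f(x) dx`, so that `∂ₓ` corresponds to multiplication by `iξ`.
(Mathlib's `𝓕` uses the kernel `e^{-2πixξ}`.) -/
def hat (f : Lp ℝ 2 (volume : Measure ℝ)) (ξ : ℝ) : ℂ :=
  (𝓕 (toComplex f) : Lp ℂ 2 (volume : Measure ℝ)) (ξ / (2 * Real.pi))

/-- The Fourier transform `∫ e^{-ixξ} g(x) dx` of an integrable function. -/
def hatL1 (g : ℝ → ℂ) (ξ : ℝ) : ℂ :=
  ∫ x : ℝ, Complex.exp (-Complex.I * x * ξ) * g x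

/-- `⟨ξ⟩ = √(1 + ξ²)`. -/
def bracket (ξ : ℝ) : ℝ := √(1 + ξ ^ 2)

/-- The weight `cosh(σ|ξ|) ⟨ξ⟩^s`. -/
def weight (σ s ξ : ℝ) : ℝ := Real.cosh (σ * |ξ|) * bracket ξ ^ s

/-- `ξ ↦ cosh(σ|ξ|) ⟨ξ⟩^s f̂(ξ)`. -/
def weightedHat (σ s : ℝ) (f : Lp ℝ 2 (volume : Measure ℝ)) (ξ : ℝ) : ℂ :=
  (weight σ s ξ : ℂ) * hat f ξ

theorem bracket_pos (ξ : ℝ) : 0 < bracket ξ := Real.sqrt_pos.2 (by positivity)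

theorem weight_pos (σ s ξ : ℝ) : 0 < weight σ s ξ :=
  mul_pos (Real.cosh_pos _) (Real.rpow_pos_of_pos (bracket_pos ξ) s)

theorem toComplex_add (f g : Lp ℝ 2 (volume : Measure ℝ)) :
    toComplex (f + g) = toComplex f + toComplex g :=
  map_add (Complex.ofRealCLM.compLpₗ 2 (volume : Measure ℝ)) f g

theorem toComplex_smul (c : ℝ) (f : Lp ℝ 2 (volume : Measure ℝ)) :
    toComplex (c • f) = (c : ℂ) • toComplex f := by
  have h : toComplex (c • f) = c • toComplex f :=
    map_smul (Complex.ofRealCLM.compLpₗ 2 (volume : Measure ℝ)) c f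
  rw [h]
  rfl

theorem toComplex_injective : Function.Injective toComplex := by
  intro f g h
  apply Lp.ext
  have hf := Complex.ofRealCLM.coeFn_compLp f
  have hg := Complex.ofRealCLM.coeFn_compLp g
  have h' : Complex.ofRealCLM.compLp f = Complex.ofRealCLM.compLp g := h
  rw [h'] at hf
  filter_upwards [hf, hg] with x h1 h2
  have h3 : ((f x : ℝ) : ℂ) = ((g x : ℝ) : ℂ) := by
    simpa using h1.symm.trans h2
  exact_mod_cast h3

theorem qmp_mul {a : ℝ} (ha : a ≠ 0) :
    Measure.QuasiMeasurePreserving (fun x : ℝ => x * a) volume volume := by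
  refine ⟨by fun_prop, ?_⟩
  rw [Real.map_volume_mul_right ha]
  exact Measure.smul_absolutelyContinuous

theorem ae_div_two_pi {p : ℝ → Prop} (h : ∀ᵐ x : ℝ, p x) :
    ∀ᵐ ξ : ℝ, p (ξ / (2 * Real.pi)) := by
  simp only [div_eq_mul_inv]
  exact (qmp_mul (inv_ne_zero (by positivity))).ae h

theorem hat_add (f g : Lp ℝ 2 (volume : Measure ℝ)) :
    hat (f + g) =ᵐ[volume] fun ξ => hat f ξ + hat g ξ := by
  have h : 𝓕 (toComplex (f + g)) = 𝓕 (toComplex f) + 𝓕 (toComplex g) := by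
    rw [toComplex_add, FourierTransform.fourier_add]
  filter_upwards [ae_div_two_pi (Lp.coeFn_add (𝓕 (toComplex f)) (𝓕 (toComplex g)))] with ξ hξ
  simpa only [hat, h, Pi.add_apply] using hξ

theorem hat_smul (c : ℝ) (f : Lp ℝ 2 (volume : Measure ℝ)) :
    hat (c • f) =ᵐ[volume] fun ξ => (c : ℂ) * hat f ξ := by
  have h : 𝓕 (toComplex (c • f)) = (c : ℂ) • 𝓕 (toComplex f) := by
    rw [toComplex_smul, FourierTransform.fourier_smul]
  filter_upwards [ae_div_two_pi (Lp.coeFn_smul (c : ℂ) (𝓕 (toComplex f)))] with ξ hξ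
  simpa only [hat, h, Pi.smul_apply, smul_eq_mul] using hξ

theorem weightedHat_add (σ s : ℝ) (f g : Lp ℝ 2 (volume : Measure ℝ)) :
    weightedHat σ s (f + g) =ᵐ[volume] weightedHat σ s f + weightedHat σ s g := by
  filter_upwards [hat_add f g] with ξ hξ
  simp only [weightedHat, hξ, Pi.add_apply]
  ring

theorem weightedHat_smul (σ s c : ℝ) (f : Lp ℝ 2 (volume : Measure ℝ)) :
    weightedHat σ s (c • f) =ᵐ[volume] c • weightedHat σ s f := by
  filter_upwards [hat_smul c f] with ξ hξ
  simp only [weightedHat, hξ, Pi.smul_apply, Complex.real_smul]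
  ring

/-- The real-valued functions `f ∈ L²(ℝ)` with `cosh(σ|ξ|) ⟨ξ⟩^s f̂ ∈ L²`. -/
def gevreySubmodule (σ s : ℝ) : Submodule ℝ (Lp ℝ 2 (volume : Measure ℝ)) where
  carrier := {f | MemLp (weightedHat σ s f) 2 volume}
  add_mem' {f g} hf hg := (memLp_congr_ae (weightedHat_add σ s f g)).2 (hf.add hg)
  zero_mem' := by
    have h := weightedHat_smul σ s 0 0
    rw [zero_smul, zero_smul] at h
    exact (memLp_congr_ae h).2 MemLp.zero
  smul_mem' c f hf := (memLp_congr_ae (weightedHat_smul σ s c f)).2 (hf.const_smul c)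

/-- The modified Gevrey space `H^{σ,s}(ℝ)` of real-valued functions. It is a type of its own (not
an abbreviation for the submodule of `L²`), because it carries the norm
`‖f‖ = ‖cosh(σ|ξ|) ⟨ξ⟩^s f̂‖_{L²}` and not the one of `L²`. -/
def GevreyH (σ s : ℝ) : Type := ↥(gevreySubmodule σ s)

namespace GevreyH

variable {σ s : ℝ}

instance : AddCommGroup (GevreyH σ s) := inferInstanceAs (AddCommGroup ↥(gevreySubmodule σ s))

instance : Module ℝ (GevreyH σ s) := inferInstanceAs (Module ℝ ↥(gevreySubmodule σ s))

/-- The underlying element of `L²(ℝ; ℝ)`. -/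
def toL2 (f : GevreyH σ s) : Lp ℝ 2 (volume : Measure ℝ) := Subtype.val f

theorem memLp (f : GevreyH σ s) : MemLp (weightedHat σ s f.toL2) 2 volume := Subtype.property f

/-- The linear map `f ↦ cosh(σ|ξ|) ⟨ξ⟩^s f̂` into `L²(ℝ; ℂ)`. -/
def weighted (σ s : ℝ) : GevreyH σ s →ₗ[ℝ] Lp ℂ 2 (volume : Measure ℝ) where
  toFun f := f.memLp.toLp _
  map_add' f g := by
    rw [← MemLp.toLp_add, MemLp.toLp_eq_toLp_iff]
    exact weightedHat_add σ s f.toL2 g.toL2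
  map_smul' c f := by
    rw [RingHom.id_apply, ← MemLp.toLp_const_smul, MemLp.toLp_eq_toLp_iff]
    exact weightedHat_smul σ s c f.toL2

theorem weighted_injective (σ s : ℝ) : Function.Injective (weighted σ s) := by
  intro f g h
  have h1 : weightedHat σ s f.toL2 =ᵐ[volume] weightedHat σ s g.toL2 :=
    (MemLp.toLp_eq_toLp_iff f.memLp g.memLp).1 h
  have h2 : ∀ᵐ ξ : ℝ, hat f.toL2 ξ = hat g.toL2 ξ := by
    filter_upwards [h1] with ξ hξ
    exact mul_left_cancel₀ (by exact_mod_cast (weight_pos σ s ξ).ne') hξ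
  have h3 : 𝓕 (toComplex f.toL2) = 𝓕 (toComplex g.toL2) := by
    apply Lp.ext
    have := (qmp_mul (a := 2 * Real.pi) (by positivity)).ae h2
    filter_upwards [this] with x hx
    simpa only [hat, mul_div_cancel_right₀ x (show (2 * Real.pi) ≠ 0 by positivity)] using hx
  have h4 : toComplex f.toL2 = toComplex g.toL2 :=
    (Lp.fourierTransformₗᵢ ℝ ℂ).injective h3
  exact Subtype.ext (toComplex_injective h4)

/-- The norm `‖f‖ = ‖cosh(σ|ξ|) ⟨ξ⟩^s f̂‖_{L²}`. -/
instance : NormedAddCommGroup (GevreyH σ s) :=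
  NormedAddCommGroup.induced (GevreyH σ s) (Lp ℂ 2 (volume : Measure ℝ)) (weighted σ s)
    (weighted_injective σ s)

instance : NormedSpace ℝ (GevreyH σ s) :=
  NormedSpace.induced ℝ (GevreyH σ s) (Lp ℂ 2 (volume : Measure ℝ)) (weighted σ s)

theorem norm_eq (f : GevreyH σ s) :
    ‖f‖ = (eLpNorm (fun ξ => ((Real.cosh (σ * |ξ|) * √(1 + ξ ^ 2) ^ s : ℝ) : ℂ) * hat f.toL2 ξ)
      2 volume).toReal :=
  Lp.norm_toLp _ f.memLp

theorem memLp_deriv (f : GevreyH σ 2) :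
    MemLp (fun k : ℝ => (2 * Real.pi * Complex.I * k) *
      (𝓕 (toComplex f.toL2) : Lp ℂ 2 (volume : Measure ℝ)) k) 2 volume := by
  have h0 : (2 * Real.pi) ≠ 0 := by positivity
  have hm : MemLp (fun k : ℝ => weightedHat σ 2 f.toL2 (k * (2 * Real.pi))) 2 volume := by
    have h1 : MemLp (weightedHat σ 2 f.toL2) 2
        (Measure.map (fun x : ℝ => x * (2 * Real.pi)) volume) := by
      rw [Real.map_volume_mul_right h0]
      exact f.memLp.smul_measure ENNReal.ofReal_ne_top
    exact h1.comp_of_map (by fun_prop)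
  refine hm.of_le ?_ (Filter.Eventually.of_forall fun k => ?_)
  · exact (by fun_prop : AEStronglyMeasurable
      (fun k : ℝ => (2 * Real.pi * Complex.I * k : ℂ)) volume).mul (Lp.aestronglyMeasurable _)
  · simp only [weightedHat, hat, mul_div_cancel_right₀ k h0, norm_mul]
    gcongr
    have hw : |k * (2 * Real.pi)| ≤ weight σ 2 (k * (2 * Real.pi)) := by
      set ξ := k * (2 * Real.pi)
      have hb : bracket ξ ^ (2 : ℝ) = 1 + ξ ^ 2 := by
        rw [Real.rpow_two, bracket, Real.sq_sqrt (by positivity)]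
      have h1 : |ξ| ≤ 1 + ξ ^ 2 := by nlinarith [sq_abs ξ, sq_nonneg (|ξ| - 1)]
      have h2 := Real.one_le_cosh (σ * |ξ|)
      rw [weight, hb]
      nlinarith [sq_nonneg ξ]
    calc ‖(2 : ℂ)‖ * ‖(Real.pi : ℂ)‖ * ‖Complex.I‖ * ‖(k : ℂ)‖ = |k * (2 * Real.pi)| := by
          simp [abs_mul, abs_of_pos Real.pi_pos]
          ring
      _ ≤ weight σ 2 (k * (2 * Real.pi)) := hw
      _ = ‖(weight σ 2 (k * (2 * Real.pi)) : ℂ)‖ := by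
          rw [Complex.norm_real, Real.norm_of_nonneg (weight_pos _ _ _).le]

/-- The derivative `∂ₓ f ∈ L²(ℝ)` of `f ∈ H^{σ,2}(ℝ)`: the inverse Fourier transform of
`iξ f̂(ξ)` (in Mathlib's normalization, of `2πik (𝓕 f)(k)`). -/
def dx (f : GevreyH σ 2) : Lp ℂ 2 (volume : Measure ℝ) :=
  𝓕⁻ (f.memLp_deriv.toLp _ : Lp ℂ 2 (volume : Measure ℝ))

end GevreyH

/-- The coefficients of the fifth order KdV-BBM equation
`∂ₜη + ∂ₓη - γ₁ ∂ₜ∂ₓ²η + γ₂ ∂ₓ³η + δ₁ ∂ₜ∂ₓ⁴η + δ₂ ∂ₓ⁵η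
  = - (3/4) ∂ₓ(η²) - γ ∂ₓ³(η²) + (7/48) ∂ₓ(ηₓ²) + (1/8) ∂ₓ(η³)`. -/
structure Coeffs where
  γ : ℝ
  γ₁ : ℝ
  γ₂ : ℝ
  δ₁ : ℝ
  δ₂ : ℝ

namespace Coeffs

/-- `1 + γ₁ ξ² + δ₁ ξ⁴`, the denominator of the symbols below. -/
def denom (p : Coeffs) (ξ : ℝ) : ℝ := 1 + p.γ₁ * ξ ^ 2 + p.δ₁ * ξ ^ 4

/-- The symbol `ξ (1 - γ₂ ξ² + δ₂ ξ⁴) / (1 + γ₁ ξ² + δ₁ ξ⁴)` of the linear part. -/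
def phi (p : Coeffs) (ξ : ℝ) : ℝ := ξ * (1 - p.γ₂ * ξ ^ 2 + p.δ₂ * ξ ^ 4) / p.denom ξ

/-- The symbol `ξ (3 - 4γ ξ²) / (4 (1 + γ₁ ξ² + δ₁ ξ⁴))`. -/
def tau (p : Coeffs) (ξ : ℝ) : ℝ := ξ * (3 - 4 * p.γ * ξ ^ 2) / (4 * p.denom ξ)

/-- The symbol `ξ / (1 + γ₁ ξ² + δ₁ ξ⁴)`. -/
def psi (p : Coeffs) (ξ : ℝ) : ℝ := ξ / p.denom ξ

/-- The Fourier transform of `F(u) = τ(D) u² - (7/48) ψ(D) uₓ² - (1/8) ψ(D) u³`. For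
`u ∈ H^{σ,2}(ℝ)` the functions `u²`, `uₓ²` and `u³` are integrable. -/
def nonlinHat (p : Coeffs) {σ : ℝ} (u : GevreyH σ 2) (ξ : ℝ) : ℂ :=
  p.tau ξ * hatL1 (fun x => (toComplex u.toL2 x) ^ 2) ξ
    - 7 / 48 * p.psi ξ * hatL1 (fun x => (u.dx x) ^ 2) ξ
    - 1 / 8 * p.psi ξ * hatL1 (fun x => (toComplex u.toL2 x) ^ 3) ξ

end Coeffs

open Classical in
/-- The extension by zero to `ℝ` of a curve defined on `[0, T]`. -/
def extendZero {E : Type} [Zero E] [TopologicalSpace E] {T : ℝ} (η : C(Icc (0 : ℝ) T, E))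
    (s : ℝ) : E :=
  if h : s ∈ Icc (0 : ℝ) T then η ⟨s, h⟩ else 0

/-- `η ∈ C([0,T]; H^{σ,2}(ℝ))` is a mild solution with initial datum `η₀`:
`η(t) = e^{-itφ(D)} η₀ - i ∫₀ᵗ e^{-i(t-s)φ(D)} F(η(s)) ds` for all `t ∈ [0,T]`, the Fourier
multipliers and the time integral being evaluated on the Fourier side. -/
def IsMildSolution (p : Coeffs) {σ T : ℝ} (η₀ : GevreyH σ 2)
    (η : C(Icc (0 : ℝ) T, GevreyH σ 2)) : Prop :=
  ∀ t : Icc (0 : ℝ) T, ∀ᵐ ξ : ℝ,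
    hat (η t).toL2 ξ =
      Complex.exp (-Complex.I * (t : ℝ) * p.phi ξ) * hat η₀.toL2 ξ
        - Complex.I * ∫ s in (0 : ℝ)..t,
            Complex.exp (-Complex.I * ((t : ℝ) - s) * p.phi ξ) * p.nonlinHat (extendZero η s) ξ

end KdVBBM

end

/-! The equation loses no derivatives. Since `φ(ξ) = 1 + γ₁ξ² + δ₁ξ⁴` has order four, `τ` has order
-1 and `ψ` has order -3, so `|τ|` and `⟨ξ⟩²|ψ|` are both bounded by a multiple of `⟨ξ⟩⁻¹`, which is
square integrable. For `F(η) ∈ H^{σ,2}` it therefore suffices to bound transforms of products in the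
supremum norm in `ξ`: that of `u²` with the full weight, those of `uₓ²` and `u³` with `cosh(σ|ξ|)`
only. A transform of a product is a convolution, both weights are submultiplicative up to constants
free of `σ`, and Cauchy-Schwarz does the rest. Applied to differences this gives `‖F(u) - F(v)‖ ≤ K
(r + r²) ‖u - v‖` on the ball of radius `r`, with `K` depending on the coefficients only
(`norm_nonlin_sub_le`).

The group `e^{-itφ(D)}` is isometric and strongly continuous, but its symbol may be unbounded. In
the interaction picture `v(t) = e^{itφ(D)} η(t)` the Duhamel formula becomes `v(t) = η₀ + ∫₀ᵗ f(s,
v(s)) ds` with `f` continuous in time and locally Lipschitz in `v` (`isMildSolution_iff`), so it is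
an ordinary differential equation in a Banach space. Picard-Lindelöf for all data in the ball of
radius `R = 1 + ‖η₀‖`, with trajectories in the ball of radius `2R`, needs only `K R² T` small,
whence the lifespan; it also gives a flow Lipschitz in the datum (`exists_flow`). Grönwall gives
uniqueness among all continuous curves (`eqOn_of_integral_eq`).

Mild solutions are defined pointwise in frequency, so one has to know that Bochner integrals in
`H^{σ,2}` are computed frequency by frequency (`hat_integral`). -/

noncomputable section

namespace KdVBBM

/-! ### Plancherel transform: products, inversion, conjugation. -/

/-- Complex-valued `L²(ℝ)`. -/
abbrev L2C : Type := Lp ℂ 2 (volume : Measure ℝ)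

theorem continuous_integral_mul {A : ℝ → ℂ} (hA : MemLp A 2 volume) :
    Continuous fun f : L2C => ∫ x, A x * f x := by
  have h : (fun f : L2C => ∫ x, A x * f x) =
      fun f => (ContinuousLinearMap.mul ℂ ℂ).lpPairing volume 2 2 (hA.toLp A) f := by
    funext f
    rw [ContinuousLinearMap.lpPairing_eq_integral]
    refine integral_congr_ae ?_
    filter_upwards [hA.coeFn_toLp] with x hx
    simp [hx]
  rw [h]
  fun_prop

theorem memLp_char_mul {f : ℝ → ℂ} (hf : MemLp f 2 volume) (k : ℝ) :
    MemLp (fun x : ℝ => (Real.fourierChar (-(x * k)) : ℂ) * f x) 2 volume := by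
  refine hf.of_le ?_ (Filter.Eventually.of_forall fun x => by
    rw [norm_mul, Circle.norm_coe, one_mul])
  have : Continuous fun x : ℝ => (Real.fourierChar (-(x * k)) : ℂ) := by
    fun_prop
  exact this.aestronglyMeasurable.mul hf.1

theorem memLp_comp_sub_left {f : ℝ → ℂ} (hf : MemLp f 2 volume) (k : ℝ) :
    MemLp (fun y : ℝ => f (k - y)) 2 volume :=
  hf.comp_measurePreserving (Measure.measurePreserving_sub_left volume k)

theorem integral_fourier_mul_flip {f g : ℝ → ℂ} (hf : Integrable f) (hg : Integrable g) :
    ∫ y, 𝓕 f y * g y = ∫ x, f x * 𝓕 g x := by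
  simpa using! VectorFourier.integral_bilin_fourierIntegral_eq_flip (ContinuousLinearMap.mul ℂ ℂ)
    (L := innerₗ ℝ) Real.continuous_fourierChar continuous_inner hf hg

theorem fourier_comp_sub_left (g : ℝ → ℂ) (k x : ℝ) :
    𝓕 (fun y => g (k - y)) x = (Real.fourierChar (-(x * k)) : ℂ) * 𝓕⁻ g x := by
  rw [Real.fourier_real_eq, Real.fourierInv_eq, ← integral_const_mul,
    ← integral_sub_left_eq_self _ volume k]
  refine integral_congr_ae (Filter.Eventually.of_forall fun y => ?_)
  simp only [Circle.smul_def, smul_eq_mul, sub_sub_cancel, ← mul_assoc, ← Circle.coe_mul,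
    ← AddChar.map_add_eq_mul]
  congr 3
  simp
  ring

/-- This is the multiplication formula for `f` and `y ↦ 𝓕 g (k - y)`; by inversion the transform of
the latter is `g` times a character. -/
theorem integral_char_mul_schwartz (f g : SchwartzMap ℝ ℂ) (k : ℝ) :
    ∫ x : ℝ, (Real.fourierChar (-(x * k)) : ℂ) * (f x * g x) = ∫ y, 𝓕 f y * 𝓕 g (k - y) := by
  have hG : Integrable fun y => 𝓕 g (k - y) := (𝓕 g).integrable.comp_sub_left k
  have h := integral_fourier_mul_flip f.integrable hG
  rw [← SchwartzMap.fourier_coe] at h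
  rw [h]
  refine integral_congr_ae (Filter.Eventually.of_forall fun x => ?_)
  have h2 : 𝓕⁻ (⇑(𝓕 g : SchwartzMap ℝ ℂ)) x = g x := by
    rw [← SchwartzMap.fourierInv_coe, FourierTransform.fourierInv_fourier_eq]
  simp only [fourier_comp_sub_left, h2]
  ring

/-- For fixed `k` both sides are `L²`-continuous in each factor separately, the right one by
Plancherel, so the identity extends from Schwartz functions by density, one factor at a time. -/
theorem integral_char_mul_L2 (f g : L2C) (k : ℝ) :
    ∫ x : ℝ, (Real.fourierChar (-(x * k)) : ℂ) * (f x * g x) =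
      ∫ y, (𝓕 f : L2C) y * (𝓕 g : L2C) (k - y) := by
  have hd : DenseRange (SchwartzMap.toLpCLM ℂ (E := ℝ) ℂ 2 volume) :=
    SchwartzMap.denseRange_toLpCLM ENNReal.ofNat_ne_top
  have hL (f g : L2C) : ∫ x : ℝ, (Real.fourierChar (-(x * k)) : ℂ) * (f x * g x) =
      ∫ x : ℝ, (Real.fourierChar (-(x * k)) : ℂ) * f x * g x := by simp only [mul_assoc]
  have hL' (f g : L2C) : ∫ x : ℝ, (Real.fourierChar (-(x * k)) : ℂ) * (f x * g x) =
      ∫ x : ℝ, (Real.fourierChar (-(x * k)) : ℂ) * g x * f x := by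
    simp only [mul_assoc, mul_comm (f _)]
  have hR (f g : L2C) : ∫ y, f y * g (k - y) = ∫ y, f (k - y) * g y := by
    rw [← integral_sub_left_eq_self _ volume k]
    simp
  refine hd.induction_on (p := fun g : L2C =>
    ∫ x : ℝ, (Real.fourierChar (-(x * k)) : ℂ) * (f x * g x) =
      ∫ y, (𝓕 f : L2C) y * (𝓕 g : L2C) (k - y)) g ?_ fun g => ?_
  · refine isClosed_eq ?_ ?_
    · simp only [hL]
      exact continuous_integral_mul (memLp_char_mul (Lp.memLp f) k)
    · simp only [hR]
      exact (continuous_integral_mul (memLp_comp_sub_left (Lp.memLp _) k)).comp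
        (Lp.fourierTransformₗᵢ ℝ ℂ).continuous
  refine hd.induction_on (p := fun f : L2C =>
    ∫ x : ℝ, (Real.fourierChar (-(x * k)) : ℂ) * (f x *
      (SchwartzMap.toLpCLM ℂ (E := ℝ) ℂ 2 volume g : L2C) x) =
      ∫ y, (𝓕 f : L2C) y * (𝓕 (SchwartzMap.toLpCLM ℂ (E := ℝ) ℂ 2 volume g : L2C) : L2C) (k - y))
      f ?_ fun f => ?_
  · refine isClosed_eq ?_ ?_
    · simp only [hL']
      exact continuous_integral_mul (memLp_char_mul (Lp.memLp _) k)
    · simp only [mul_comm _ ((𝓕 (SchwartzMap.toLpCLM ℂ (E := ℝ) ℂ 2 volume g : L2C) : L2C) _)]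
      exact (continuous_integral_mul (memLp_comp_sub_left (Lp.memLp _) k)).comp
        (Lp.fourierTransformₗᵢ ℝ ℂ).continuous
  · simp only [SchwartzMap.toLpCLM_apply, SchwartzMap.toLp_fourier_eq]
    have e1 : ∫ x : ℝ, (Real.fourierChar (-(x * k)) : ℂ) * (f.toLp 2 volume x * g.toLp 2 volume x)
        = ∫ x : ℝ, (Real.fourierChar (-(x * k)) : ℂ) * (f x * g x) := by
      refine integral_congr_ae ?_
      filter_upwards [f.coeFn_toLp 2 volume, g.coeFn_toLp 2 volume] with x h1 h2
      rw [h1, h2]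
    rw [e1, integral_char_mul_schwartz]
    refine integral_congr_ae ?_
    filter_upwards [(𝓕 f).coeFn_toLp 2 volume,
      (Measure.measurePreserving_sub_left volume k).quasiMeasurePreserving.ae
        ((𝓕 g).coeFn_toLp 2 volume)] with x h1 h2
    rw [h1, h2]

theorem integral_mul_L2 (f g : L2C) :
    ∫ x : ℝ, f x * g x = ∫ y, (𝓕 f : L2C) y * (𝓕 g : L2C) (-y) := by
  simpa using integral_char_mul_L2 f g 0

theorem integral_schwartz_mul (φ : SchwartzMap ℝ ℂ) (g : L2C) :
    ∫ x : ℝ, φ x * g x = ∫ y, 𝓕 φ y * (𝓕 g : L2C) (-y) := by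
  have h := integral_mul_L2 (φ.toLp 2 volume) g
  rw [SchwartzMap.toLp_fourier_eq] at h
  have h1 : ∫ x, φ.toLp 2 volume x * g x = ∫ x, φ x * g x := by
    refine integral_congr_ae ?_
    filter_upwards [φ.coeFn_toLp 2 volume] with x h1
    rw [h1]
  rw [← h1, h]
  refine integral_congr_ae ?_
  filter_upwards [(𝓕 φ).coeFn_toLp 2 volume] with x h1
  rw [h1]

theorem ae_eq_of_forall_schwartz {f g : ℝ → ℂ} (hf : LocallyIntegrable f)
    (hg : LocallyIntegrable g)
    (h : ∀ φ : SchwartzMap ℝ ℂ, ∫ x, φ x * f x = ∫ x, φ x * g x) : f =ᵐ[volume] g := by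
  refine ae_eq_of_integral_contDiff_smul_eq hf hg fun φ hφ hs => ?_
  have hs' : HasCompactSupport fun x => (φ x : ℂ) := hs.comp_left (g := Complex.ofReal) rfl
  have hφ' : ContDiff ℝ (⊤ : ℕ∞) fun x => (φ x : ℂ) := Complex.ofRealCLM.contDiff.comp hφ
  simpa using h (hs'.toSchwartzMap hφ')

theorem locallyIntegrable_L2 (f : L2C) : LocallyIntegrable f :=
  (Lp.memLp f).locallyIntegrable (by norm_num)

/-- On `L¹ ∩ L²` the Plancherel transform is the Fourier integral. -/
theorem fourier_ae_eq_of_integrable (h : L2C) (hi : Integrable h) :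
    (𝓕 h : L2C) =ᵐ[volume] 𝓕 (h : ℝ → ℂ) := by
  have hc : Continuous (𝓕 (h : ℝ → ℂ)) := by
    simpa using! VectorFourier.fourierIntegral_continuous Real.continuous_fourierChar
      (L := innerₗ ℝ) continuous_inner hi
  -- Both transforms can be moved onto a Schwartz test function. For the Plancherel transform this
  -- uses the product formula with `𝓕 φ`, because `𝓕 (𝓕 φ)` is the reflection of `φ`.
  refine ae_eq_of_forall_schwartz (locallyIntegrable_L2 _) hc.locallyIntegrable fun φ => ?_
  have h1 := integral_fourier_mul_flip φ.integrable hi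
  rw [← SchwartzMap.fourier_coe] at h1
  rw [← h1, integral_schwartz_mul (𝓕 φ), ← integral_neg_eq_self]
  refine integral_congr_ae (Filter.Eventually.of_forall fun y => ?_)
  have h2 : 𝓕 (𝓕 φ) y = φ (-y) := by
    rw [← neg_neg y, SchwartzMap.fourier_coe, ← Real.fourierInv_eq_fourier_neg,
      ← SchwartzMap.fourierInv_coe,
      FourierTransform.fourierInv_fourier_eq, neg_neg]
  simp [h2]

/-- A function of `L²` whose transform is integrable is essentially bounded. -/
theorem ae_norm_le_of_integrable_fourier (h : L2C) (hi : Integrable (𝓕 h : L2C)) :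
    ∀ᵐ x, ‖h x‖ ≤ ∫ y, ‖(𝓕 h : L2C) y‖ := by
  have hi' : Integrable fun y => (𝓕 h : L2C) (-y) := hi.comp_neg
  have hc : Continuous (𝓕 (fun y => (𝓕 h : L2C) (-y))) := by
    simpa using! VectorFourier.fourierIntegral_continuous Real.continuous_fourierChar
      (L := innerₗ ℝ) continuous_inner hi'
  -- Inversion: `h` is a.e. the Fourier integral of the reflected transform, hence bounded by the
  -- `L¹` norm of that transform.
  have key : h =ᵐ[volume] 𝓕 (fun y => (𝓕 h : L2C) (-y)) := by
    refine ae_eq_of_forall_schwartz (locallyIntegrable_L2 _) hc.locallyIntegrable fun φ => ?_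
    rw [integral_schwartz_mul, ← integral_fourier_mul_flip φ.integrable hi',
      SchwartzMap.fourier_coe]
  filter_upwards [key] with x hx
  rw [hx]
  rw [← integral_neg_eq_self (fun y => ‖(𝓕 h : L2C) y‖)]
  exact VectorFourier.norm_fourierIntegral_le_integral_norm _ _ _ _ _

/-- Parseval against an arbitrary `𝓕 G`: the pairing of `f` with `G` is `∫ (star f) G`, which the
product formula rewrites in terms of `𝓕 (star f)` reflected. -/
theorem fourier_star (f : L2C) :
    (𝓕 (star f) : L2C) =ᵐ[volume] fun y => star ((𝓕 f : L2C) (-y)) := by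
  have hm : MemLp (fun y => (𝓕 (star f) : L2C) (-y)) 2 volume := by
    simpa using memLp_comp_sub_left (Lp.memLp (𝓕 (star f) : L2C)) 0
  have key : star hm.toLp = (𝓕 f : L2C) := by
    refine ext_inner_right ℂ fun G' => ?_
    obtain ⟨G, rfl⟩ : ∃ G : L2C, 𝓕 G = G' := ⟨𝓕⁻ G', FourierTransform.fourier_fourierInv_eq G'⟩
    rw [Lp.inner_fourier_eq, L2.inner_def, L2.inner_def]
    have h1 : ∫ x, inner ℂ (f x) (G x) = ∫ x, (star f : L2C) x * G x := by
      refine integral_congr_ae ?_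
      filter_upwards [Lp.coeFn_star f] with x hx
      rw [hx]
      simp [mul_comm]
    rw [h1, integral_mul_L2, ← integral_neg_eq_self (fun y => (𝓕 (star f) : L2C) y * _)]
    refine integral_congr_ae ?_
    filter_upwards [Lp.coeFn_star hm.toLp, hm.coeFn_toLp] with y h2 h3
    rw [h2, Pi.star_apply, h3]
    simp [mul_comm]
  have h4 : ∀ᵐ y, star ((𝓕 (star f) : L2C) (-y)) = (𝓕 f : L2C) y := by
    rw [← key]
    filter_upwards [Lp.coeFn_star hm.toLp, hm.coeFn_toLp] with y h2 h3
    rw [h2, Pi.star_apply, h3]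
  filter_upwards [(Measure.measurePreserving_neg (volume : Measure ℝ)).quasiMeasurePreserving.ae h4]
    with y hy
  rw [← hy]
  simp


/-! ### Real-valued functions on the Fourier side; completeness of `H^{σ,2}`. -/

theorem ae_mul_two_pi {p : ℝ → Prop} (h : ∀ᵐ x : ℝ, p x) :
    ∀ᵐ k : ℝ, p (k * (2 * Real.pi)) :=
  (qmp_mul (by positivity)).ae h

theorem ae_neg {p : ℝ → Prop} (h : ∀ᵐ x : ℝ, p x) : ∀ᵐ x : ℝ, p (-x) :=
  (Measure.measurePreserving_neg (volume : Measure ℝ)).quasiMeasurePreserving.ae h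

theorem memLp_comp_mul {V : ℝ → ℂ} {a : ℝ} (ha : a ≠ 0) (hV : MemLp V 2 volume) :
    MemLp (fun k : ℝ => V (k * a)) 2 volume := by
  have h1 : MemLp V 2 (Measure.map (fun x : ℝ => x * a) volume) := by
    rw [Real.map_volume_mul_right ha]
    exact hV.smul_measure ENNReal.ofReal_ne_top
  exact h1.comp_of_map (by fun_prop)

theorem hat_mul_two_pi (f : Lp ℝ 2 (volume : Measure ℝ)) (k : ℝ) :
    hat f (k * (2 * Real.pi)) = (𝓕 (toComplex f) : L2C) k := by
  simp [hat, mul_div_cancel_right₀ k (show (2 * Real.pi) ≠ 0 by positivity)]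

theorem hat_ext {f g : Lp ℝ 2 (volume : Measure ℝ)} (h : hat f =ᵐ[volume] hat g) : f = g := by
  have h3 : 𝓕 (toComplex f) = 𝓕 (toComplex g) := by
    apply Lp.ext
    filter_upwards [ae_mul_two_pi h] with x hx
    simpa only [hat_mul_two_pi] using hx
  exact toComplex_injective ((Lp.fourierTransformₗᵢ ℝ ℂ).injective h3)

theorem coeFn_toComplex (f : Lp ℝ 2 (volume : Measure ℝ)) :
    toComplex f =ᵐ[volume] fun x => (f x : ℂ) :=
  Complex.ofRealCLM.coeFn_compLp f

theorem star_toComplex (f : Lp ℝ 2 (volume : Measure ℝ)) : star (toComplex f) = toComplex f := by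
  apply Lp.ext
  filter_upwards [Lp.coeFn_star (toComplex f), coeFn_toComplex f] with x h1 h2
  rw [h1, Pi.star_apply, h2]
  simp

theorem hat_neg (f : Lp ℝ 2 (volume : Measure ℝ)) :
    ∀ᵐ ξ, hat f (-ξ) = star (hat f ξ) := by
  have h := fourier_star (toComplex f)
  rw [star_toComplex] at h
  filter_upwards [ae_div_two_pi (ae_neg h)] with ξ hξ
  simpa [hat, neg_div] using hξ

/-- The inverse transform of a Hermitian `V` is fixed by conjugation, so it coincides with its real
part. Every element of `H^{σ,2}` constructed from a prescribed transform comes from here. -/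
theorem exists_hat_eq {V : ℝ → ℂ} (hV : MemLp V 2 volume) (hs : ∀ᵐ ξ, V (-ξ) = star (V ξ)) :
    ∃ f : Lp ℝ 2 (volume : Measure ℝ), hat f =ᵐ[volume] V := by
  have hm : MemLp (fun k : ℝ => V (k * (2 * Real.pi))) 2 volume :=
    memLp_comp_mul (by positivity) hV
  set F : L2C := 𝓕⁻ (hm.toLp : L2C) with hF
  have hFF : 𝓕 F = hm.toLp := FourierTransform.fourier_fourierInv_eq _
  have hstar : star F = F := by
    apply (Lp.fourierTransformₗᵢ ℝ ℂ).injective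
    change 𝓕 (star F) = 𝓕 F
    apply Lp.ext
    have h1 := fourier_star F
    rw [hFF] at h1 ⊢
    filter_upwards [h1, hm.coeFn_toLp, ae_neg hm.coeFn_toLp, ae_mul_two_pi hs] with k h2 h3 h4 h5
    rw [h2, h4, h3, neg_mul, h5, star_star]
  refine ⟨Complex.reCLM.compLp F, ?_⟩
  have hc : toComplex (Complex.reCLM.compLp F) = F := by
    apply Lp.ext
    have h0 := Lp.coeFn_star F
    rw [hstar] at h0
    filter_upwards [coeFn_toComplex (Complex.reCLM.compLp F), Complex.reCLM.coeFn_compLp F, h0]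
      with x h1 h2 h3
    rw [h1, h2]
    exact Complex.conj_eq_iff_re.1 h3.symm
  filter_upwards [ae_div_two_pi hm.coeFn_toLp] with ξ h1
  rw [hat, hc, hFF, h1, div_mul_cancel₀ ξ (by positivity)]

theorem bracket_rpow_two (ξ : ℝ) : bracket ξ ^ (2 : ℝ) = 1 + ξ ^ 2 := by
  rw [Real.rpow_two, bracket, Real.sq_sqrt (by positivity)]

theorem weight_two (σ ξ : ℝ) : weight σ 2 ξ = Real.cosh (σ * |ξ|) * (1 + ξ ^ 2) := by
  rw [weight, bracket_rpow_two]

theorem one_le_weight (σ ξ : ℝ) : 1 ≤ weight σ 2 ξ := by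
  rw [weight_two]
  nlinarith [Real.one_le_cosh (σ * |ξ|), sq_nonneg ξ]

theorem weight_neg (σ s ξ : ℝ) : weight σ s (-ξ) = weight σ s ξ := by simp [weight, bracket]

theorem norm_weight (σ s ξ : ℝ) : ‖(weight σ s ξ : ℂ)‖ = weight σ s ξ := by
  rw [Complex.norm_real, Real.norm_of_nonneg (weight_pos _ _ _).le]

theorem continuous_weight (σ s : ℝ) : Continuous (weight σ s) := by
  have h : Continuous bracket := by unfold bracket; fun_prop
  unfold weight
  refine (by fun_prop : Continuous fun ξ : ℝ => Real.cosh (σ * |ξ|)).mul ?_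
  exact h.rpow_const fun ξ => Or.inl (bracket_pos ξ).ne'

namespace GevreyH

variable {σ : ℝ}

theorem toL2_injective {s : ℝ} : Function.Injective (toL2 : GevreyH σ s → _) :=
  Subtype.val_injective

theorem ext_hat {s : ℝ} {f g : GevreyH σ s} (h : hat f.toL2 =ᵐ[volume] hat g.toL2) : f = g :=
  toL2_injective (hat_ext h)

theorem exists_of_weighted {W : ℝ → ℂ} (hW : MemLp W 2 volume)
    (hs : ∀ᵐ ξ, W (-ξ) = star (W ξ)) :
    ∃ f : GevreyH σ 2, ∀ᵐ ξ, weightedHat σ 2 f.toL2 ξ = W ξ := by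
  have hV : MemLp (fun ξ => ((weight σ 2 ξ)⁻¹ : ℝ) * W ξ) 2 volume := by
    refine hW.of_le ?_ (Filter.Eventually.of_forall fun ξ => ?_)
    · refine AEStronglyMeasurable.mul (Continuous.aestronglyMeasurable ?_) hW.1
      exact Complex.continuous_ofReal.comp
        ((continuous_weight σ 2).inv₀ fun ξ => (weight_pos _ _ _).ne')
    · rw [norm_mul, Complex.norm_real, Real.norm_of_nonneg (inv_nonneg.2 (weight_pos _ _ _).le)]
      exact mul_le_of_le_one_left (norm_nonneg _) (inv_le_one_of_one_le₀ (one_le_weight _ _))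
  obtain ⟨f, hf⟩ := exists_hat_eq hV (by
    filter_upwards [hs] with ξ h
    simp [weight_neg, h])
  have hw : weightedHat σ 2 f =ᵐ[volume] W := by
    filter_upwards [hf] with ξ h
    rw [weightedHat, h, ← mul_assoc, ← Complex.ofReal_mul, mul_inv_cancel₀ (weight_pos _ _ _).ne']
    simp
  exact ⟨⟨f, (memLp_congr_ae hw).2 hW⟩, hw⟩

theorem exists_of_hat {V : ℝ → ℂ} (hV : MemLp (fun ξ => (weight σ 2 ξ : ℂ) * V ξ) 2 volume)
    (hs : ∀ᵐ ξ, V (-ξ) = star (V ξ)) :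
    ∃ f : GevreyH σ 2, hat f.toL2 =ᵐ[volume] V := by
  obtain ⟨f, hf⟩ := exists_of_weighted hV (by
    filter_upwards [hs] with ξ h
    simp [weight_neg, h])
  refine ⟨f, ?_⟩
  filter_upwards [hf] with ξ h
  exact mul_left_cancel₀ (by exact_mod_cast (weight_pos σ 2 ξ).ne') h

theorem norm_eq_weighted {s : ℝ} (f : GevreyH σ s) : ‖f‖ = ‖weighted σ s f‖ := rfl

theorem coeFn_weighted {s : ℝ} (f : GevreyH σ s) :
    weighted σ s f =ᵐ[volume] weightedHat σ s f.toL2 := f.memLp.coeFn_toLp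

theorem isometry_weighted (s : ℝ) : Isometry (weighted σ s) :=
  AddMonoidHomClass.isometry_of_norm _ fun _ => rfl

/-- The weight is real and even, so it preserves Hermitian symmetry, and dividing by it stays in
`L²` because it is at least 1. The range of the isometry is thus a closed subset of `L²`, which
yields completeness. -/
theorem range_weighted :
    range (weighted σ 2) = {W : L2C | ∀ᵐ ξ, W (-ξ) = star (W ξ)} := by
  ext W
  constructor
  · rintro ⟨f, rfl⟩
    filter_upwards [coeFn_weighted f, ae_neg (coeFn_weighted f), hat_neg f.toL2] with ξ h1 h2 h3
    rw [h1, h2]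
    simp [weightedHat, weight_neg, h3]
  · intro h
    obtain ⟨f, hf⟩ := exists_of_weighted (σ := σ) (Lp.memLp W) h
    refine ⟨f, Lp.ext ?_⟩
    filter_upwards [hf, coeFn_weighted f] with ξ h1 h2
    rw [h2, h1]

theorem isClosed_hermitian : IsClosed {W : L2C | ∀ᵐ ξ, W (-ξ) = star (W ξ)} := by
  have hn := Measure.measurePreserving_neg (volume : Measure ℝ)
  have h : {W : L2C | ∀ᵐ ξ, W (-ξ) = star (W ξ)} =
      {W : L2C | Lp.compMeasurePreserving Neg.neg hn W =
        (Complex.conjCLE : ℂ →L[ℝ] ℂ).compLp W} := by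
    ext W
    simp only [mem_ofPred_eq]
    have h1 := Lp.coeFn_compMeasurePreserving W hn
    have h2 := (Complex.conjCLE : ℂ →L[ℝ] ℂ).coeFn_compLp W
    constructor
    · intro h
      apply Lp.ext
      filter_upwards [h, h1, h2] with ξ a b c
      rw [b, c]
      exact a
    · intro h
      rw [h] at h1
      filter_upwards [h1, h2] with ξ b c
      exact b.symm.trans c
  rw [h]
  refine isClosed_eq (Lp.isometry_compMeasurePreserving hn).continuous ?_
  exact ((Complex.conjCLE : ℂ →L[ℝ] ℂ).compLpL 2 volume).continuous

instance : CompleteSpace (GevreyH σ 2) := by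
  rw [completeSpace_iff_isComplete_range (isometry_weighted 2).isUniformInducing, range_weighted]
  exact isClosed_hermitian.isComplete

/-- Converts pointwise bounds in frequency into norm bounds; used with `b = ⟨ξ⟩⁻¹`, the decay left
over by the symbols. -/
theorem norm_le_of_ae_le (f : GevreyH σ 2) {b : ℝ → ℝ} (hb : MemLp b 2 volume) {C : ℝ}
    (hC : 0 ≤ C)
    (h : ∀ᵐ ξ, weight σ 2 ξ * ‖hat f.toL2 ξ‖ ≤ C * ‖b ξ‖) :
    ‖f‖ ≤ C * (eLpNorm b 2 volume).toReal := by
  have h1 : eLpNorm (weighted σ 2 f) 2 volume ≤ ENNReal.ofReal C * eLpNorm b 2 volume := by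
    refine eLpNorm_le_mul_eLpNorm_of_ae_le_mul ?_ 2
    filter_upwards [h, coeFn_weighted f] with ξ a b
    rw [b, weightedHat, norm_mul, norm_weight]
    exact a
  rw [norm_eq_weighted, Lp.norm_def]
  refine (ENNReal.toReal_mono (ENNReal.mul_ne_top ENNReal.ofReal_ne_top hb.2.ne) h1).trans ?_
  rw [ENNReal.toReal_mul, ENNReal.toReal_ofReal hC]

theorem hat_toL2_add (f g : GevreyH σ 2) :
    hat (f + g).toL2 =ᵐ[volume] fun ξ => hat f.toL2 ξ + hat g.toL2 ξ := hat_add f.toL2 g.toL2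

theorem hat_toL2_smul (c : ℝ) (f : GevreyH σ 2) :
    hat (c • f).toL2 =ᵐ[volume] fun ξ => c * hat f.toL2 ξ := hat_smul c f.toL2

theorem hat_toL2_sub (f g : GevreyH σ 2) :
    hat (f - g).toL2 =ᵐ[volume] fun ξ => hat f.toL2 ξ - hat g.toL2 ξ := by
  have h : f - g = f + (-1 : ℝ) • g := by module
  rw [h]
  filter_upwards [hat_toL2_add f ((-1 : ℝ) • g), hat_toL2_smul (-1) g] with ξ h1 h2
  rw [h1, h2]
  push_cast
  ring

end GevreyH


/-! ### Convolution estimates, Fourier integrals and submultiplicative weights. -/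

/-- The `L²` norm of a function, as a real number. -/
def l2norm (f : ℝ → ℂ) : ℝ := (eLpNorm f 2 volume).toReal

theorem l2norm_nonneg (f : ℝ → ℂ) : 0 ≤ l2norm f := ENNReal.toReal_nonneg

theorem l2norm_le_of_ae_le {f g : ℝ → ℂ} (hg : MemLp g 2 volume) {C : ℝ} (hC : 0 ≤ C)
    (h : ∀ᵐ x, ‖f x‖ ≤ C * ‖g x‖) : l2norm f ≤ C * l2norm g := by
  have h1 : eLpNorm f 2 volume ≤ ENNReal.ofReal C * eLpNorm g 2 volume :=
    eLpNorm_le_mul_eLpNorm_of_ae_le_mul h 2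
  refine (ENNReal.toReal_mono (ENNReal.mul_ne_top ENNReal.ofReal_ne_top hg.2.ne) h1).trans ?_
  rw [ENNReal.toReal_mul, ENNReal.toReal_ofReal hC, l2norm]

theorem integral_norm_mul_le {f g : ℝ → ℂ} (hf : MemLp f 2 volume) (hg : MemLp g 2 volume) :
    ∫ x, ‖f x‖ * ‖g x‖ ≤ l2norm f * l2norm g := by
  have h := real_inner_le_norm (hf.norm.toLp _) (hg.norm.toLp _)
  rw [Lp.norm_toLp, Lp.norm_toLp, eLpNorm_norm, eLpNorm_norm, L2.inner_def] at h
  refine le_trans (le_of_eq (integral_congr_ae ?_)) h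
  filter_upwards [hf.norm.coeFn_toLp, hg.norm.coeFn_toLp] with x h1 h2
  rw [h1, h2]
  simp [mul_comm]

theorem l2norm_comp_sub_left {f : ℝ → ℂ} (hf : MemLp f 2 volume) (k : ℝ) :
    l2norm (fun y => f (k - y)) = l2norm f := by
  rw [l2norm, l2norm]
  congr 1
  exact eLpNorm_comp_measurePreserving hf.1 (Measure.measurePreserving_sub_left volume k)

/-- Convolutions of functions in weighted `L²` spaces are bounded, with a weight. -/
theorem weight_mul_norm_convolution_le {m₁ m₂ : ℝ → ℝ} {M C k : ℝ} {f g : ℝ → ℂ} (hC : 0 ≤ C)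
    (hM : 0 ≤ M) (h : ∀ y, M ≤ C * (|m₁ y| * |m₂ (k - y)|))
    (hf : MemLp (fun y => (m₁ y : ℂ) * f y) 2 volume)
    (hg : MemLp (fun y => (m₂ y : ℂ) * g y) 2 volume) :
    M * ‖∫ y, f y * g (k - y)‖ ≤
      C * (l2norm (fun y => (m₁ y : ℂ) * f y) * l2norm (fun y => (m₂ y : ℂ) * g y)) := by
  have hg' := memLp_comp_sub_left hg k
  have hi : Integrable fun y => ‖(m₁ y : ℂ) * f y‖ * ‖(m₂ (k - y) : ℂ) * g (k - y)‖ :=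
    hf.norm.integrable_mul hg'.norm
  calc M * ‖∫ y, f y * g (k - y)‖ ≤ M * ∫ y, ‖f y * g (k - y)‖ := by
        gcongr
        exact norm_integral_le_integral_norm _
    _ = ∫ y, M * ‖f y * g (k - y)‖ := (integral_const_mul _ _).symm
    _ ≤ ∫ y, C * (‖(m₁ y : ℂ) * f y‖ * ‖(m₂ (k - y) : ℂ) * g (k - y)‖) := by
        refine integral_mono_of_nonneg (Filter.Eventually.of_forall fun y => by positivity)
          (hi.const_mul C) (Filter.Eventually.of_forall fun y => ?_)
        simp only [norm_mul, Complex.norm_real, Real.norm_eq_abs]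
        calc M * (‖f y‖ * ‖g (k - y)‖)
            ≤ C * (|m₁ y| * |m₂ (k - y)|) * (‖f y‖ * ‖g (k - y)‖) := by
              gcongr
              exact h y
          _ = _ := by ring
    _ = C * ∫ y, ‖(m₁ y : ℂ) * f y‖ * ‖(m₂ (k - y) : ℂ) * g (k - y)‖ := integral_const_mul _ _
    _ ≤ _ := by
        gcongr
        refine (integral_norm_mul_le hf hg').trans_eq ?_
        rw [l2norm_comp_sub_left hg k]

theorem hatL1_eq_char (g : ℝ → ℂ) (ξ : ℝ) :
    hatL1 g ξ = ∫ x : ℝ, (Real.fourierChar (-(x * (ξ / (2 * Real.pi)))) : ℂ) * g x := by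
  refine integral_congr_ae (Filter.Eventually.of_forall fun x => ?_)
  simp only [Real.fourierChar_apply]
  congr 2
  push_cast
  have : (Real.pi : ℂ) ≠ 0 := by exact_mod_cast Real.pi_ne_zero
  field_simp

theorem hatL1_eq_fourier (g : ℝ → ℂ) (k : ℝ) :
    hatL1 g (k * (2 * Real.pi)) = 𝓕 g k := by
  rw [hatL1_eq_char, Real.fourier_real_eq,
    mul_div_cancel_right₀ k (show (2 * Real.pi) ≠ 0 by positivity)]
  rfl

/-- No factor `2π` appears because the convolution is taken in the variable `k = ξ / (2π)`. -/
theorem hatL1_mul (f g : L2C) (ξ : ℝ) :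
    hatL1 (fun x => f x * g x) ξ = ∫ y, (𝓕 f : L2C) y * (𝓕 g : L2C) (ξ / (2 * Real.pi) - y) := by
  rw [hatL1_eq_char, integral_char_mul_L2]

theorem integrable_exp_mul {g : ℝ → ℂ} (hg : Integrable g) (ξ : ℝ) :
    Integrable fun x : ℝ => Complex.exp (-Complex.I * x * ξ) * g x := by
  refine hg.bdd_mul (c := 1) (Continuous.aestronglyMeasurable (by fun_prop))
    (Filter.Eventually.of_forall fun x => ?_)
  rw [Complex.norm_exp]
  simp

theorem hatL1_add {f g : ℝ → ℂ} (hf : Integrable f) (hg : Integrable g) (ξ : ℝ) :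
    hatL1 (fun x => f x + g x) ξ = hatL1 f ξ + hatL1 g ξ := by
  simp only [hatL1, mul_add]
  exact integral_add (integrable_exp_mul hf ξ) (integrable_exp_mul hg ξ)

theorem hatL1_sub {f g : ℝ → ℂ} (hf : Integrable f) (hg : Integrable g) (ξ : ℝ) :
    hatL1 (fun x => f x - g x) ξ = hatL1 f ξ - hatL1 g ξ := by
  simp only [hatL1, mul_sub]
  exact integral_sub (integrable_exp_mul hf ξ) (integrable_exp_mul hg ξ)

theorem hatL1_congr {f g : ℝ → ℂ} (h : f =ᵐ[volume] g) (ξ : ℝ) : hatL1 f ξ = hatL1 g ξ := by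
  refine integral_congr_ae ?_
  filter_upwards [h] with x hx
  rw [hx]

theorem continuous_hatL1 {g : ℝ → ℂ} (hg : Integrable g) : Continuous (hatL1 g) := by
  refine continuous_of_dominated (bound := fun x => ‖g x‖)
    (fun ξ => (integrable_exp_mul hg ξ).1) (fun ξ => Filter.Eventually.of_forall fun x => ?_)
    hg.norm (Filter.Eventually.of_forall fun x => by fun_prop)
  rw [norm_mul, Complex.norm_exp]
  simp

theorem hatL1_neg_of_real {g : ℝ → ℂ} (hg : ∀ᵐ x, star (g x) = g x) (ξ : ℝ) :
    hatL1 g (-ξ) = star (hatL1 g ξ) := by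
  rw [hatL1, hatL1, Complex.star_def, ← integral_conj]
  refine integral_congr_ae ?_
  filter_upwards [hg] with x hx
  rw [Complex.star_def] at hx
  simp [map_mul, hx, ← Complex.exp_conj]

theorem integrable_mul_L2 (f g : L2C) : Integrable fun x => f x * g x :=
  (Lp.memLp f).integrable_mul (Lp.memLp g)

/-- `⟨ξ⟩⁻¹`, as a square integrable function. -/
theorem memLp_inv_bracket : MemLp (fun ξ => (bracket ξ)⁻¹) 2 volume := by
  have hc : Continuous fun ξ => (bracket ξ)⁻¹ :=
    Continuous.inv₀ (by unfold bracket; fun_prop) fun ξ => (bracket_pos ξ).ne'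
  rw [memLp_two_iff_integrable_sq hc.aestronglyMeasurable]
  refine integrable_inv_one_add_sq.congr (Filter.Eventually.of_forall fun ξ => ?_)
  simp only [inv_pow, bracket]
  rw [Real.sq_sqrt (by positivity)]

theorem memLp_inv_bracket_complex : MemLp (fun ξ => (((bracket ξ)⁻¹ : ℝ) : ℂ)) 2 volume :=
  memLp_inv_bracket.ofReal

theorem one_le_bracket (ξ : ℝ) : 1 ≤ bracket ξ := by
  rw [bracket, Real.one_le_sqrt]
  nlinarith [sq_nonneg ξ]

theorem bracket_sq (ξ : ℝ) : bracket ξ ^ 2 = 1 + ξ ^ 2 := Real.sq_sqrt (by positivity)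

theorem abs_le_bracket (ξ : ℝ) : |ξ| ≤ bracket ξ := by
  rw [bracket]
  exact Real.abs_le_sqrt (by linarith)

theorem bracket_le_one_add_sq (ξ : ℝ) : bracket ξ ≤ 1 + ξ ^ 2 := by
  rw [← bracket_sq]
  nlinarith [one_le_bracket ξ]

/-- `cosh (a + b) + cosh (a - b) = 2 cosh a cosh b`, and the second term is positive. The constant
is free of `σ`, which is what makes the final `c` independent of `σ₀`. -/
theorem cosh_submul (σ a b : ℝ) :
    Real.cosh (σ * |a + b|) ≤ 2 * (Real.cosh (σ * |a|) * Real.cosh (σ * |b|)) := by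
  have h (x : ℝ) : Real.cosh (σ * |x|) = Real.cosh (σ * x) := by
    rcases abs_choice x with h | h <;> rw [h]
    rw [mul_neg, Real.cosh_neg]
  rw [h, h, h, mul_add, Real.cosh_add]
  nlinarith [Real.cosh_pos (σ * a - σ * b), Real.cosh_sub (σ * a) (σ * b)]

theorem weight_submul (σ a b : ℝ) :
    weight σ 2 (a + b) ≤ 4 * (weight σ 2 a * weight σ 2 b) := by
  rw [weight_two, weight_two, weight_two]
  have h1 := cosh_submul σ a b
  have h2 : 1 + (a + b) ^ 2 ≤ 2 * ((1 + a ^ 2) * (1 + b ^ 2)) := by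
    nlinarith [sq_nonneg (a - b), sq_nonneg (a * b)]
  have h3 := Real.cosh_pos (σ * |a|)
  have h4 := Real.cosh_pos (σ * |b|)
  calc _ ≤ (2 * (Real.cosh (σ * |a|) * Real.cosh (σ * |b|))) *
        (2 * ((1 + a ^ 2) * (1 + b ^ 2))) := by gcongr
    _ = _ := by ring

/-! ### Bilinear and trilinear estimates, pointwise in frequency. -/

/-- `L²(ℝ; ℂ)` representative of `f ∈ H^{σ,2}`. -/
def GevreyH.toC {σ : ℝ} (f : GevreyH σ 2) : L2C := toComplex f.toL2

namespace GevreyH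

variable {σ : ℝ}

theorem toC_add (f g : GevreyH σ 2) : (f + g).toC = f.toC + g.toC := toComplex_add _ _

theorem toC_smul (c : ℝ) (f : GevreyH σ 2) : (c • f).toC = (c : ℂ) • f.toC := toComplex_smul _ _

theorem fourier_dx (f : GevreyH σ 2) :
    (𝓕 f.dx : L2C) =ᵐ[volume] fun k : ℝ => (2 * Real.pi * Complex.I * k) * (𝓕 f.toC : L2C) k := by
  rw [dx, FourierTransform.fourier_fourierInv_eq]
  exact f.memLp_deriv.coeFn_toLp

theorem dx_add (f g : GevreyH σ 2) : (f + g).dx = f.dx + g.dx := by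
  apply (Lp.fourierTransformₗᵢ ℝ ℂ).injective
  change 𝓕 (f + g).dx = 𝓕 (f.dx + g.dx)
  rw [FourierTransform.fourier_add]
  have h := fourier_dx (f + g)
  rw [toC_add, FourierTransform.fourier_add] at h
  apply Lp.ext
  filter_upwards [h, fourier_dx f, fourier_dx g, Lp.coeFn_add (𝓕 f.dx : L2C) (𝓕 g.dx),
    Lp.coeFn_add (𝓕 f.toC : L2C) (𝓕 g.toC)] with x h1 h2 h3 h4 h5
  rw [h1, h4, h5, Pi.add_apply, Pi.add_apply, h2, h3, mul_add]

theorem dx_smul (c : ℝ) (f : GevreyH σ 2) : (c • f).dx = (c : ℂ) • f.dx := by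
  apply (Lp.fourierTransformₗᵢ ℝ ℂ).injective
  change 𝓕 (c • f).dx = 𝓕 ((c : ℂ) • f.dx)
  rw [FourierTransform.fourier_smul]
  have h := fourier_dx (c • f)
  rw [toC_smul, FourierTransform.fourier_smul] at h
  apply Lp.ext
  filter_upwards [h, fourier_dx f, Lp.coeFn_smul (c : ℂ) (𝓕 f.dx : L2C),
    Lp.coeFn_smul (c : ℂ) (𝓕 f.toC : L2C)] with x h1 h2 h4 h5
  rw [h1, h4, h5, Pi.smul_apply, Pi.smul_apply, h2]
  simp only [smul_eq_mul]
  ring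

theorem toC_sub (f g : GevreyH σ 2) : (f - g).toC = f.toC - g.toC := by
  have h : f - g = f + (-1 : ℝ) • g := by module
  rw [h, toC_add, toC_smul]
  push_cast
  module

theorem dx_sub (f g : GevreyH σ 2) : (f - g).dx = f.dx - g.dx := by
  have h : f - g = f + (-1 : ℝ) • g := by module
  rw [h, dx_add, dx_smul]
  push_cast
  module

theorem star_dx (f : GevreyH σ 2) : star f.dx = f.dx := by
  apply (Lp.fourierTransformₗᵢ ℝ ℂ).injective
  change 𝓕 (star f.dx) = 𝓕 f.dx
  have h := fourier_star f.toC
  rw [toC, star_toComplex, ← toC] at h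
  apply Lp.ext
  filter_upwards [fourier_star f.dx, fourier_dx f, ae_neg (fourier_dx f), h] with k h1 h2 h3 h4
  rw [h1, h2, h3, h4]
  simp

theorem memLp_weight (f : GevreyH σ 2) :
    MemLp (fun k : ℝ => (weight σ 2 (k * (2 * Real.pi)) : ℂ) * (𝓕 f.toC : L2C) k) 2 volume := by
  have h := memLp_comp_mul (a := 2 * Real.pi) (by positivity) f.memLp
  simpa only [weightedHat, hat_mul_two_pi] using! h

/-- The substitution `ξ = 2πk` produces a factor `(2π)^{-1/2} ≤ 1`, which is discarded. -/
theorem l2norm_weight_le (f : GevreyH σ 2) :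
    l2norm (fun k : ℝ => (weight σ 2 (k * (2 * Real.pi)) : ℂ) * (𝓕 f.toC : L2C) k) ≤ ‖f‖ := by
  have h0 : (2 * Real.pi) ≠ 0 := by positivity
  have h1 : (fun k : ℝ => (weight σ 2 (k * (2 * Real.pi)) : ℂ) * (𝓕 f.toC : L2C) k) =
      weightedHat σ 2 f.toL2 ∘ fun k : ℝ => k * (2 * Real.pi) := by
    funext k
    simp only [Function.comp, weightedHat, hat_mul_two_pi]
    rfl
  have hmap := Real.map_volume_mul_right h0
  have hle : ENNReal.ofReal |(2 * Real.pi)⁻¹| • (volume : Measure ℝ) ≤ volume := by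
    have h2 : ENNReal.ofReal |(2 * Real.pi)⁻¹| ≤ 1 := by
      rw [ENNReal.ofReal_le_one, abs_of_pos (by positivity)]
      exact inv_le_one_of_one_le₀ (by nlinarith [Real.pi_gt_three])
    intro s
    simpa using mul_le_of_le_one_left (zero_le) h2
  have h3 : eLpNorm (fun k : ℝ => (weight σ 2 (k * (2 * Real.pi)) : ℂ) * (𝓕 f.toC : L2C) k) 2 volume
      ≤ eLpNorm (weightedHat σ 2 f.toL2) 2 volume := by
    rw [h1, ← eLpNorm_map_measure, hmap]
    · exact eLpNorm_mono_measure _ hle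
    · rw [hmap]
      exact f.memLp.1.mono_measure hle
    · fun_prop
  rw [norm_eq_weighted, Lp.norm_def, l2norm, eLpNorm_congr_ae (coeFn_weighted f)]
  exact ENNReal.toReal_mono f.memLp.2.ne h3

/-- If `|ĥ| ≤ ⟨ξ⟩² |f̂|`, then `cosh(σ|ξ|) ĥ` is in `L²`, with norm at most `‖f‖`. -/
theorem cosh_bound (f : GevreyH σ 2) {h : L2C}
    (hh : ∀ᵐ k : ℝ, ‖(𝓕 h : L2C) k‖ ≤ (1 + (k * (2 * Real.pi)) ^ 2) * ‖(𝓕 f.toC : L2C) k‖) :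
    MemLp (fun k : ℝ => (Real.cosh (σ * |k * (2 * Real.pi)|) : ℂ) * (𝓕 h : L2C) k) 2 volume ∧
    l2norm (fun k : ℝ => (Real.cosh (σ * |k * (2 * Real.pi)|) : ℂ) * (𝓕 h : L2C) k) ≤ ‖f‖ := by
  have hle : ∀ᵐ k : ℝ, ‖(Real.cosh (σ * |k * (2 * Real.pi)|) : ℂ) * (𝓕 h : L2C) k‖ ≤
      1 * ‖(weight σ 2 (k * (2 * Real.pi)) : ℂ) * (𝓕 f.toC : L2C) k‖ := by
    filter_upwards [hh] with k hk
    rw [norm_mul, norm_mul, norm_weight, weight_two, Complex.norm_real,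
      Real.norm_of_nonneg (Real.cosh_pos _).le, one_mul, mul_assoc]
    gcongr
  refine ⟨(memLp_weight f).of_le_mul ?_ hle, ?_⟩
  · have : Continuous fun k : ℝ => (Real.cosh (σ * |k * (2 * Real.pi)|) : ℂ) := by fun_prop
    exact this.aestronglyMeasurable.mul (Lp.aestronglyMeasurable _)
  · refine (l2norm_le_of_ae_le (memLp_weight f) zero_le_one hle).trans ?_
    rw [one_mul]
    exact l2norm_weight_le f

theorem cosh_bound_self (f : GevreyH σ 2) :
    MemLp (fun k : ℝ => (Real.cosh (σ * |k * (2 * Real.pi)|) : ℂ) * (𝓕 f.toC : L2C) k) 2 volume ∧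
    l2norm (fun k : ℝ => (Real.cosh (σ * |k * (2 * Real.pi)|) : ℂ) * (𝓕 f.toC : L2C) k) ≤ ‖f‖ :=
  f.cosh_bound (Filter.Eventually.of_forall fun k =>
    le_mul_of_one_le_left (norm_nonneg _) (by nlinarith [sq_nonneg (k * (2 * Real.pi))]))

theorem cosh_bound_dx (f : GevreyH σ 2) :
    MemLp (fun k : ℝ => (Real.cosh (σ * |k * (2 * Real.pi)|) : ℂ) * (𝓕 f.dx : L2C) k) 2 volume ∧
    l2norm (fun k : ℝ => (Real.cosh (σ * |k * (2 * Real.pi)|) : ℂ) * (𝓕 f.dx : L2C) k) ≤ ‖f‖ := by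
  refine f.cosh_bound ?_
  filter_upwards [fourier_dx f] with k hk
  rw [hk, norm_mul]
  gcongr
  have h1 : ‖(2 * Real.pi * Complex.I * k : ℂ)‖ = |k * (2 * Real.pi)| := by
    simp [abs_mul, abs_of_pos Real.pi_pos]
    ring
  rw [h1]
  exact (abs_le_bracket _).trans (bracket_le_one_add_sq _)

/-- Cauchy-Schwarz in the convolution after splitting the whole weight over the two factors. A
supremum bound in `ξ` suffices, since square integrability comes later from `τ`. -/
theorem hatL1_mul_bound (f g : GevreyH σ 2) (ξ : ℝ) :
    weight σ 2 ξ * ‖hatL1 (fun x => f.toC x * g.toC x) ξ‖ ≤ 4 * (‖f‖ * ‖g‖) := by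
  rw [hatL1_mul]
  refine (weight_mul_norm_convolution_le (C := 4)
    (m₁ := fun k => weight σ 2 (k * (2 * Real.pi))) (m₂ := fun k => weight σ 2 (k * (2 * Real.pi)))
    (by norm_num) (weight_pos _ _ _).le (fun y => ?_) (memLp_weight f) (memLp_weight g)).trans ?_
  · rw [abs_of_pos (weight_pos _ _ _), abs_of_pos (weight_pos _ _ _)]
    refine le_trans (le_of_eq ?_) (weight_submul σ _ _)
    congr 1
    field_simp
    ring
  · gcongr
    · exact l2norm_nonneg _
    · exact l2norm_weight_le f
    · exact l2norm_weight_le g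

/-- Only the exponential weight is split, so factors such as `dx` with less decay are admissible;
the missing `⟨ξ⟩²` is supplied by `ψ`. -/
theorem cosh_mul_hatL1_le {f g : L2C}
    (hf : MemLp (fun k : ℝ => (Real.cosh (σ * |k * (2 * Real.pi)|) : ℂ) * (𝓕 f : L2C) k) 2 volume)
    (hg : MemLp (fun k : ℝ => (Real.cosh (σ * |k * (2 * Real.pi)|) : ℂ) * (𝓕 g : L2C) k) 2 volume)
    (ξ : ℝ) :
    Real.cosh (σ * |ξ|) * ‖hatL1 (fun x => f x * g x) ξ‖ ≤
      2 * (l2norm (fun k : ℝ => (Real.cosh (σ * |k * (2 * Real.pi)|) : ℂ) * (𝓕 f : L2C) k) *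
        l2norm (fun k : ℝ => (Real.cosh (σ * |k * (2 * Real.pi)|) : ℂ) * (𝓕 g : L2C) k)) := by
  rw [hatL1_mul]
  refine weight_mul_norm_convolution_le (C := 2)
    (m₁ := fun k => Real.cosh (σ * |k * (2 * Real.pi)|))
    (m₂ := fun k => Real.cosh (σ * |k * (2 * Real.pi)|))
    (by norm_num) (Real.cosh_pos _).le (fun y => ?_) hf hg
  rw [abs_of_pos (Real.cosh_pos _), abs_of_pos (Real.cosh_pos _)]
  refine le_trans (le_of_eq ?_) (cosh_submul σ _ _)
  congr 3
  field_simp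
  ring

theorem hatL1_dx_mul_bound (f g : GevreyH σ 2) (ξ : ℝ) :
    Real.cosh (σ * |ξ|) * ‖hatL1 (fun x => f.dx x * g.dx x) ξ‖ ≤ 2 * (‖f‖ * ‖g‖) := by
  refine (cosh_mul_hatL1_le f.cosh_bound_dx.1 g.cosh_bound_dx.1 ξ).trans ?_
  gcongr
  · exact l2norm_nonneg _
  · exact f.cosh_bound_dx.2
  · exact g.cosh_bound_dx.2

theorem one_add_sq_le_weight (σ k : ℝ) : 1 + k ^ 2 ≤ weight σ 2 (k * (2 * Real.pi)) := by
  rw [weight_two]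
  have h1 : 1 + k ^ 2 ≤ 1 + (k * (2 * Real.pi)) ^ 2 := by
    rw [mul_pow]
    have : 1 ≤ (2 * Real.pi) ^ 2 := by nlinarith [Real.pi_gt_three]
    nlinarith [sq_nonneg k]
  exact h1.trans (le_mul_of_one_le_left (by positivity) (Real.one_le_cosh _))

/-- Sobolev embedding by Cauchy-Schwarz against `⟨k⟩⁻¹`. It makes `f` essentially bounded, so
products lie in `L²` and cubes are integrable. -/
theorem integrable_fourier (f : GevreyH σ 2) : Integrable (𝓕 f.toC : L2C) := by
  have h := (memLp_weight f).norm.integrable_mul memLp_inv_bracket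
  refine h.mono (Lp.aestronglyMeasurable _) (Filter.Eventually.of_forall fun k => ?_)
  have hb := bracket_pos k
  rw [Pi.mul_apply, Real.norm_of_nonneg (by positivity), norm_mul, norm_weight]
  have h1 : bracket k ≤ weight σ 2 (k * (2 * Real.pi)) :=
    (bracket_le_one_add_sq k).trans (one_add_sq_le_weight σ k)
  rw [← div_eq_mul_inv, le_div_iff₀ hb, mul_comm]
  gcongr

theorem memLp_mul (f g : GevreyH σ 2) : MemLp (fun x => f.toC x * g.toC x) 2 volume := by
  refine (Lp.memLp g.toC).of_le_mul (c := ∫ y, ‖(𝓕 f.toC : L2C) y‖)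
    ((Lp.aestronglyMeasurable _).mul (Lp.aestronglyMeasurable _)) ?_
  filter_upwards [ae_norm_le_of_integrable_fourier f.toC f.integrable_fourier] with x hx
  rw [norm_mul]
  gcongr

/-- The product of two functions of `H^{σ,2}`, in `L²`. -/
def mul (f g : GevreyH σ 2) : L2C := (memLp_mul f g).toLp _

theorem coeFn_mul (f g : GevreyH σ 2) : f.mul g =ᵐ[volume] fun x => f.toC x * g.toC x :=
  (memLp_mul f g).coeFn_toLp

theorem fourier_mul (f g : GevreyH σ 2) :
    ∀ᵐ k : ℝ, (𝓕 (f.mul g) : L2C) k =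
      hatL1 (fun x => f.toC x * g.toC x) (k * (2 * Real.pi)) := by
  have hi : Integrable (f.mul g) := (integrable_mul_L2 f.toC g.toC).congr (coeFn_mul f g).symm
  filter_upwards [fourier_ae_eq_of_integrable _ hi] with k hk
  rw [hk, ← hatL1_eq_fourier]
  exact hatL1_congr (coeFn_mul f g) _

/-- The `L²` norm of `⟨ξ⟩⁻¹`. -/
def bracketNorm : ℝ := l2norm fun ξ => (((bracket ξ)⁻¹ : ℝ) : ℂ)

theorem bracketNorm_nonneg : 0 ≤ bracketNorm := l2norm_nonneg _

/-- The bilinear bound carries `⟨ξ⟩²`; giving it up leaves at least the square integrable decay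
`⟨k⟩⁻¹`. Hence a product can itself be a factor in `cosh_mul_hatL1_le`, which handles the cubic
term. -/
theorem cosh_bound_mul (f g : GevreyH σ 2) :
    MemLp (fun k : ℝ => (Real.cosh (σ * |k * (2 * Real.pi)|) : ℂ) * (𝓕 (f.mul g) : L2C) k)
      2 volume ∧
    l2norm (fun k : ℝ => (Real.cosh (σ * |k * (2 * Real.pi)|) : ℂ) * (𝓕 (f.mul g) : L2C) k) ≤
      4 * (‖f‖ * ‖g‖) * bracketNorm := by
  have hle : ∀ᵐ k : ℝ, ‖(Real.cosh (σ * |k * (2 * Real.pi)|) : ℂ) * (𝓕 (f.mul g) : L2C) k‖ ≤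
      4 * (‖f‖ * ‖g‖) * ‖(((bracket k)⁻¹ : ℝ) : ℂ)‖ := by
    filter_upwards [fourier_mul f g] with k hk
    have hb := bracket_pos k
    have h1 := hatL1_mul_bound f g (k * (2 * Real.pi))
    rw [weight_two] at h1
    rw [norm_mul, Complex.norm_real, Complex.norm_real, Real.norm_of_nonneg (Real.cosh_pos _).le,
      Real.norm_of_nonneg (inv_nonneg.2 hb.le), ← div_eq_mul_inv, le_div_iff₀ hb, hk]
    refine le_trans ?_ h1
    have h2 : bracket k ≤ 1 + (k * (2 * Real.pi)) ^ 2 := by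
      have := one_add_sq_le_weight 0 k
      rw [weight_two] at this
      simp only [zero_mul, Real.cosh_zero, one_mul] at this
      exact (bracket_le_one_add_sq k).trans this
    have h3 := Real.cosh_pos (σ * |k * (2 * Real.pi)|)
    rw [mul_right_comm]
    gcongr
  refine ⟨memLp_inv_bracket_complex.of_le_mul ?_ hle,
    l2norm_le_of_ae_le memLp_inv_bracket_complex (by positivity) hle⟩
  have : Continuous fun k : ℝ => (Real.cosh (σ * |k * (2 * Real.pi)|) : ℂ) := by fun_prop
  exact this.aestronglyMeasurable.mul (Lp.aestronglyMeasurable _)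

theorem integrable_mul_mul (f g h : GevreyH σ 2) :
    Integrable fun x => f.toC x * (g.toC x * h.toC x) :=
  (Lp.memLp f.toC).integrable_mul (memLp_mul g h)

theorem hatL1_mul_mul_bound (f g h : GevreyH σ 2) (ξ : ℝ) :
    Real.cosh (σ * |ξ|) * ‖hatL1 (fun x => f.toC x * (g.toC x * h.toC x)) ξ‖ ≤
      8 * bracketNorm * (‖f‖ * (‖g‖ * ‖h‖)) := by
  have h1 : hatL1 (fun x => f.toC x * (g.toC x * h.toC x)) ξ =
      hatL1 (fun x => f.toC x * g.mul h x) ξ := by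
    refine hatL1_congr ?_ ξ
    filter_upwards [coeFn_mul g h] with x hx
    rw [hx]
  rw [h1]
  refine (cosh_mul_hatL1_le f.cosh_bound_self.1 (cosh_bound_mul g h).1 ξ).trans ?_
  calc _ ≤ 2 * (‖f‖ * (4 * (‖g‖ * ‖h‖) * bracketNorm)) := by
        gcongr
        · exact l2norm_nonneg _
        · exact f.cosh_bound_self.2
        · exact (cosh_bound_mul g h).2
    _ = _ := by ring

end GevreyH


/-! ### Decay and parity of the symbols. -/

namespace Coeffs

variable {p : Coeffs}

/-- A bound for `(1 + ξ²)² / (1 + γ₁ ξ² + δ₁ ξ⁴)`. -/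
def denomConst (p : Coeffs) : ℝ := 2 + 2 / p.δ₁

theorem denom_pos (hγ₁ : 0 < p.γ₁) (hδ₁ : 0 < p.δ₁) (ξ : ℝ) : 0 < p.denom ξ := by
  unfold denom
  positivity

theorem denomConst_pos (hδ₁ : 0 < p.δ₁) : 0 < p.denomConst := by
  unfold denomConst
  positivity

/-- `(1 + ξ²)² ≤ 2 + 2ξ⁴`; the summands `2` and `2/δ₁` of the constant pay for the two terms, and
`γ₁ξ²` is dropped. -/
theorem sq_le_denom (hγ₁ : 0 < p.γ₁) (hδ₁ : 0 < p.δ₁) (ξ : ℝ) :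
    (1 + ξ ^ 2) ^ 2 ≤ p.denomConst * p.denom ξ := by
  have h1 : p.denomConst * (1 + p.δ₁ * ξ ^ 4) ≤ p.denomConst * p.denom ξ := by
    have := (denomConst_pos hδ₁).le
    gcongr
    unfold denom
    nlinarith [sq_nonneg ξ]
  refine le_trans ?_ h1
  have h2 : p.denomConst * (1 + p.δ₁ * ξ ^ 4) = 2 + 2 * ξ ^ 4 + (2 / p.δ₁ + 2 * p.δ₁ * ξ ^ 4) := by
    unfold denomConst
    field_simp
    ring
  rw [h2]
  have h3 : 0 ≤ 2 / p.δ₁ + 2 * p.δ₁ * ξ ^ 4 := by positivity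
  nlinarith [sq_nonneg (ξ ^ 2 - 1)]

/-- Order -3: two powers absorb the `⟨ξ⟩²` of the norm and one is kept for integrability. -/
theorem abs_psi_le (hγ₁ : 0 < p.γ₁) (hδ₁ : 0 < p.δ₁) (ξ : ℝ) :
    (1 + ξ ^ 2) * |p.psi ξ| ≤ p.denomConst * (bracket ξ)⁻¹ := by
  have hd := denom_pos hγ₁ hδ₁ ξ
  have hb := bracket_pos ξ
  rw [psi, abs_div, abs_of_pos hd, ← div_eq_mul_inv, le_div_iff₀ hb, ← mul_div_assoc,
    div_mul_eq_mul_div, div_le_iff₀ hd]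
  refine le_trans ?_ (sq_le_denom hγ₁ hδ₁ ξ)
  have h1 : |ξ| * bracket ξ ≤ 1 + ξ ^ 2 := by
    rw [← bracket_sq, sq]
    gcongr
    exact abs_le_bracket ξ
  calc (1 + ξ ^ 2) * |ξ| * bracket ξ = (1 + ξ ^ 2) * (|ξ| * bracket ξ) := by ring
    _ ≤ (1 + ξ ^ 2) * (1 + ξ ^ 2) := by gcongr
    _ = _ := by ring

theorem tau_eq (p : Coeffs) (ξ : ℝ) : p.tau ξ = (3 - 4 * p.γ * ξ ^ 2) / 4 * p.psi ξ := by
  rw [tau, psi]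
  by_cases h : p.denom ξ = 0
  · simp [h]
  · field_simp

/-- Order -1: nothing is left to absorb `⟨ξ⟩²`, so the term `u²` must be estimated with the full
weight. -/
theorem abs_tau_le (hγ₁ : 0 < p.γ₁) (hδ₁ : 0 < p.δ₁) (ξ : ℝ) :
    |p.tau ξ| ≤ (1 + |p.γ|) * p.denomConst * (bracket ξ)⁻¹ := by
  rw [tau_eq, abs_mul]
  have h1 : |(3 - 4 * p.γ * ξ ^ 2) / 4| ≤ (1 + |p.γ|) * (1 + ξ ^ 2) := by
    rw [abs_le]
    constructor <;>
      nlinarith [neg_abs_le p.γ, le_abs_self p.γ, sq_nonneg ξ, abs_nonneg p.γ,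
        mul_nonneg (sub_nonneg.2 (le_abs_self p.γ)) (sq_nonneg ξ),
        mul_nonneg (neg_le_iff_add_nonneg.1 (neg_abs_le p.γ)) (sq_nonneg ξ)]
  calc _ ≤ (1 + |p.γ|) * (1 + ξ ^ 2) * |p.psi ξ| := by gcongr
    _ = (1 + |p.γ|) * ((1 + ξ ^ 2) * |p.psi ξ|) := by ring
    _ ≤ (1 + |p.γ|) * (p.denomConst * (bracket ξ)⁻¹) :=
        mul_le_mul_of_nonneg_left (abs_psi_le hγ₁ hδ₁ ξ) (by positivity)
    _ = _ := by ring

theorem continuous_denom (p : Coeffs) : Continuous p.denom := by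
  unfold denom
  fun_prop

theorem continuous_psi (hγ₁ : 0 < p.γ₁) (hδ₁ : 0 < p.δ₁) : Continuous p.psi :=
  continuous_id.div p.continuous_denom fun ξ => (denom_pos hγ₁ hδ₁ ξ).ne'

theorem continuous_tau (hγ₁ : 0 < p.γ₁) (hδ₁ : 0 < p.δ₁) : Continuous p.tau := by
  have h : p.tau = fun ξ => (3 - 4 * p.γ * ξ ^ 2) / 4 * p.psi ξ := funext p.tau_eq
  have := continuous_psi hγ₁ hδ₁
  rw [h]
  fun_prop

theorem continuous_phi (hγ₁ : 0 < p.γ₁) (hδ₁ : 0 < p.δ₁) : Continuous p.phi :=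
  Continuous.div (by fun_prop) p.continuous_denom fun ξ => (denom_pos hγ₁ hδ₁ ξ).ne'

theorem denom_neg (p : Coeffs) (ξ : ℝ) : p.denom (-ξ) = p.denom ξ := by
  simp [denom, (by decide : Even 4).neg_pow]

theorem psi_neg (p : Coeffs) (ξ : ℝ) : p.psi (-ξ) = -p.psi ξ := by simp [psi, denom_neg, neg_div]

theorem tau_neg (p : Coeffs) (ξ : ℝ) : p.tau (-ξ) = -p.tau ξ := by simp [tau_eq, psi_neg]

theorem phi_neg (p : Coeffs) (ξ : ℝ) : p.phi (-ξ) = -p.phi ξ := by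
  simp [phi, denom_neg, neg_div, (by decide : Even 4).neg_pow]

/-- The constant of the Lipschitz estimate for the nonlinearity. -/
def nonlinConst (p : Coeffs) : ℝ :=
  p.denomConst * (8 * (1 + |p.γ|) + 1 + 3 * GevreyH.bracketNorm)

theorem nonlinConst_pos (hδ₁ : 0 < p.δ₁) : 0 < p.nonlinConst := by
  have := denomConst_pos hδ₁
  have := GevreyH.bracketNorm_nonneg
  unfold nonlinConst
  positivity

end Coeffs

/-! ### Local Lipschitz estimate for the nonlinearity. -/

theorem hatL1_sq_sub (f g : L2C) (ξ : ℝ) :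
    hatL1 (fun x => f x ^ 2) ξ - hatL1 (fun x => g x ^ 2) ξ =
      hatL1 (fun x => (f - g : L2C) x * (f + g : L2C) x) ξ := by
  have hf := integrable_mul_L2 f f
  have hg := integrable_mul_L2 g g
  simp only [sq]
  rw [← hatL1_sub hf hg]
  refine hatL1_congr ?_ ξ
  filter_upwards [Lp.coeFn_sub f g, Lp.coeFn_add f g] with x h1 h2
  rw [h1, h2, Pi.sub_apply, Pi.add_apply]
  ring

namespace GevreyH

variable {σ : ℝ} {p : Coeffs}

theorem hatL1_cube_sub (u v : GevreyH σ 2) (ξ : ℝ) :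
    hatL1 (fun x => u.toC x ^ 3) ξ - hatL1 (fun x => v.toC x ^ 3) ξ =
      hatL1 (fun x => (u - v).toC x * (u.toC x * u.toC x)) ξ +
      hatL1 (fun x => (u - v).toC x * (u.toC x * v.toC x)) ξ +
      hatL1 (fun x => (u - v).toC x * (v.toC x * v.toC x)) ξ := by
  have hu : Integrable fun x => u.toC x ^ 3 :=
    (integrable_mul_mul u u u).congr (Filter.Eventually.of_forall fun x => by ring)
  have hv : Integrable fun x => v.toC x ^ 3 :=
    (integrable_mul_mul v v v).congr (Filter.Eventually.of_forall fun x => by ring)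
  have h2 : Integrable fun x => (u - v).toC x * (u.toC x * u.toC x) +
      (u - v).toC x * (u.toC x * v.toC x) :=
    (integrable_mul_mul _ _ _).add (integrable_mul_mul _ _ _)
  rw [← hatL1_sub hu hv, ← hatL1_add (integrable_mul_mul _ _ _) (integrable_mul_mul _ _ _),
    ← hatL1_add h2 (integrable_mul_mul _ _ _)]
  refine hatL1_congr ?_ ξ
  rw [toC_sub]
  filter_upwards [Lp.coeFn_sub u.toC v.toC] with x h1
  rw [h1, Pi.sub_apply]
  ring

/-- Differences of squares and cubes factor through `u - v`, and the cofactors have size `O(r)` and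
`O(r²)`; the symbol bounds then leave exactly `⟨ξ⟩⁻¹`. -/
theorem nonlinHat_sub_bound (hγ₁ : 0 < p.γ₁) (hδ₁ : 0 < p.δ₁) {u v : GevreyH σ 2} {r : ℝ}
    (hu : ‖u‖ ≤ r) (hv : ‖v‖ ≤ r) (ξ : ℝ) :
    weight σ 2 ξ * ‖p.nonlinHat u ξ - p.nonlinHat v ξ‖ ≤
      p.nonlinConst * (r + r ^ 2) * ‖u - v‖ * (bracket ξ)⁻¹ := by
  have hr : 0 ≤ r := (norm_nonneg u).trans hu
  have hb : 0 < (bracket ξ)⁻¹ := inv_pos.2 (bracket_pos ξ)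
  have hw := weight_pos σ 2 ξ
  have hc := Real.cosh_pos (σ * |ξ|)
  have hN := bracketNorm_nonneg
  have hD := Coeffs.denomConst_pos hδ₁
  have hsum : ‖u + v‖ ≤ 2 * r := (norm_add_le u v).trans (by linarith)
  set A := hatL1 (fun x => (u - v).toC x * (u + v).toC x) ξ with hA
  set B := hatL1 (fun x => (u - v).dx x * (u + v).dx x) ξ with hB
  set C := hatL1 (fun x => u.toC x ^ 3) ξ - hatL1 (fun x => v.toC x ^ 3) ξ with hC
  have eq : p.nonlinHat u ξ - p.nonlinHat v ξ =
      p.tau ξ * A - 7 / 48 * p.psi ξ * B - 1 / 8 * p.psi ξ * C := by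
    rw [hA, hB, hC, toC_sub, toC_add, dx_sub, dx_add, ← hatL1_sq_sub, ← hatL1_sq_sub]
    simp only [Coeffs.nonlinHat, toC]
    ring
  have bA : weight σ 2 ξ * ‖A‖ ≤ 8 * r * ‖u - v‖ := by
    refine (hatL1_mul_bound (u - v) (u + v) ξ).trans ?_
    calc 4 * (‖u - v‖ * ‖u + v‖) ≤ 4 * (‖u - v‖ * (2 * r)) := by gcongr
      _ = _ := by ring
  have bB : Real.cosh (σ * |ξ|) * ‖B‖ ≤ 4 * r * ‖u - v‖ := by
    refine (hatL1_dx_mul_bound (u - v) (u + v) ξ).trans ?_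
    calc 2 * (‖u - v‖ * ‖u + v‖) ≤ 2 * (‖u - v‖ * (2 * r)) := by gcongr
      _ = _ := by ring
  have bC : Real.cosh (σ * |ξ|) * ‖C‖ ≤ 24 * bracketNorm * r ^ 2 * ‖u - v‖ := by
    rw [hC, hatL1_cube_sub]
    have b3 {a b : GevreyH σ 2} (ha : ‖a‖ ≤ r) (hb : ‖b‖ ≤ r) :
        Real.cosh (σ * |ξ|) * ‖hatL1 (fun x => (u - v).toC x * (a.toC x * b.toC x)) ξ‖ ≤
          8 * bracketNorm * r ^ 2 * ‖u - v‖ := by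
      refine (hatL1_mul_mul_bound (u - v) a b ξ).trans ?_
      calc 8 * bracketNorm * (‖u - v‖ * (‖a‖ * ‖b‖))
          ≤ 8 * bracketNorm * (‖u - v‖ * (r * r)) := by gcongr
        _ = _ := by ring
    refine (mul_le_mul_of_nonneg_left norm_add₃_le hc.le).trans ?_
    rw [mul_add, mul_add]
    linarith [b3 hu hu, b3 hu hv, b3 hv hv]
  have hτ := Coeffs.abs_tau_le hγ₁ hδ₁ ξ
  have hψ := Coeffs.abs_psi_le hγ₁ hδ₁ ξ
  have tA : weight σ 2 ξ * ‖p.tau ξ * A‖ ≤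
      (1 + |p.γ|) * p.denomConst * (bracket ξ)⁻¹ * (8 * r * ‖u - v‖) := by
    rw [norm_mul, Complex.norm_real, Real.norm_eq_abs, mul_left_comm]
    gcongr
  have tψ {Z : ℂ} {R q : ℝ} (hq : 0 ≤ q) (hZ : Real.cosh (σ * |ξ|) * ‖Z‖ ≤ R) (hR : 0 ≤ R) :
      weight σ 2 ξ * ‖(q : ℂ) * p.psi ξ * Z‖ ≤ q * (p.denomConst * (bracket ξ)⁻¹ * R) := by
    rw [norm_mul, norm_mul, Complex.norm_real, Complex.norm_real, Real.norm_eq_abs,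
      Real.norm_eq_abs, abs_of_nonneg hq, weight_two]
    calc _ = q * (((1 + ξ ^ 2) * |p.psi ξ|) * (Real.cosh (σ * |ξ|) * ‖Z‖)) := by ring
      _ ≤ _ := by gcongr
  have tB := tψ (q := 7 / 48) (by norm_num) bB (by positivity)
  have tC := tψ (q := 1 / 8) (by norm_num) bC (by positivity)
  push_cast at tB tC
  rw [eq]
  have h3 : ‖p.tau ξ * A - 7 / 48 * p.psi ξ * B - 1 / 8 * p.psi ξ * C‖ ≤
      ‖p.tau ξ * A‖ + ‖7 / 48 * p.psi ξ * B‖ + ‖1 / 8 * p.psi ξ * C‖ :=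
    (norm_sub_le _ _).trans (by gcongr; exact norm_sub_le _ _)
  refine (mul_le_mul_of_nonneg_left h3 hw.le).trans ?_
  rw [mul_add, mul_add]
  refine (add_le_add (add_le_add tA tB) tC).trans ?_
  have hx : 0 ≤ p.denomConst * (bracket ξ)⁻¹ * ‖u - v‖ := by positivity
  have hγ := abs_nonneg p.γ
  -- The coefficients are `8(1 + |γ|)` from `τ`, `4 · 7/48 ≤ 1` from `uₓ²` and `24/8 = 3` from `u³`.
  have : (1 + |p.γ|) * 8 * r + 7 / 48 * 4 * r + 1 / 8 * (24 * bracketNorm * r ^ 2) ≤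
      (8 * (1 + |p.γ|) + 1 + 3 * bracketNorm) * (r + r ^ 2) := by
    nlinarith [mul_nonneg hγ (sq_nonneg r), mul_nonneg hN hr, sq_nonneg r]
  calc _ = p.denomConst * (bracket ξ)⁻¹ * ‖u - v‖ *
        ((1 + |p.γ|) * 8 * r + 7 / 48 * 4 * r + 1 / 8 * (24 * bracketNorm * r ^ 2)) := by ring
    _ ≤ p.denomConst * (bracket ξ)⁻¹ * ‖u - v‖ *
        ((8 * (1 + |p.γ|) + 1 + 3 * bracketNorm) * (r + r ^ 2)) := by gcongr
    _ = _ := by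
      rw [Coeffs.nonlinConst]
      ring

theorem nonlinHat_zero (ξ : ℝ) : p.nonlinHat (0 : GevreyH σ 2) ξ = 0 := by
  have h0 : (0 : GevreyH σ 2).toC = 0 := by
    simpa using toC_smul 0 (0 : GevreyH σ 2)
  have h1 : (0 : GevreyH σ 2).dx = 0 := by
    simpa using dx_smul 0 (0 : GevreyH σ 2)
  have h2 : toComplex (0 : GevreyH σ 2).toL2 = 0 := h0
  have h3 (n : ℕ) (hn : n ≠ 0) : hatL1 (fun x => (0 : L2C) x ^ n) ξ = 0 := by
    rw [hatL1_congr (g := fun _ => 0)]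
    · simp [hatL1]
    · filter_upwards [Lp.coeFn_zero ℂ 2 (volume : Measure ℝ)] with x hx
      rw [hx, Pi.zero_apply, zero_pow hn]
  rw [Coeffs.nonlinHat, h1, h2, h3 2 two_ne_zero, h3 3 three_ne_zero]
  simp

theorem nonlinHat_bound (hγ₁ : 0 < p.γ₁) (hδ₁ : 0 < p.δ₁) (u : GevreyH σ 2) (ξ : ℝ) :
    weight σ 2 ξ * ‖p.nonlinHat u ξ‖ ≤
      p.nonlinConst * (‖u‖ + ‖u‖ ^ 2) * ‖u‖ * (bracket ξ)⁻¹ := by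
  simpa [nonlinHat_zero] using
    nonlinHat_sub_bound hγ₁ hδ₁ (u := u) (v := 0) (r := ‖u‖) le_rfl (by simp) ξ

theorem continuous_nonlinHat (hγ₁ : 0 < p.γ₁) (hδ₁ : 0 < p.δ₁) (u : GevreyH σ 2) :
    Continuous (p.nonlinHat u) := by
  have h1 : Continuous (hatL1 fun x => toComplex u.toL2 x ^ 2) :=
    continuous_hatL1 ((integrable_mul_L2 u.toC u.toC).congr
      (Filter.Eventually.of_forall fun x => by simp only [sq, toC]))
  have h2 : Continuous (hatL1 fun x => u.dx x ^ 2) :=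
    continuous_hatL1 ((integrable_mul_L2 u.dx u.dx).congr
      (Filter.Eventually.of_forall fun x => by simp only [sq]))
  have h3 : Continuous (hatL1 fun x => toComplex u.toL2 x ^ 3) :=
    continuous_hatL1 ((integrable_mul_mul u u u).congr
      (Filter.Eventually.of_forall fun x => by simp only [toC]; ring))
  have h4 := Coeffs.continuous_tau hγ₁ hδ₁
  have h5 := Coeffs.continuous_psi hγ₁ hδ₁
  unfold Coeffs.nonlinHat
  fun_prop

/-- The symbols are real and odd, so `F(u)` is purely imaginary and only `-iF(u)` is real-valued.
This is why `nonlin` includes the factor `-i`. -/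
theorem nonlinHat_neg (u : GevreyH σ 2) (ξ : ℝ) :
    -Complex.I * p.nonlinHat u (-ξ) = star (-Complex.I * p.nonlinHat u ξ) := by
  have hu : ∀ᵐ x, star (toComplex u.toL2 x) = toComplex u.toL2 x := by
    filter_upwards [coeFn_toComplex u.toL2] with x hx
    simp [hx]
  have hd : ∀ᵐ x, star (u.dx x) = u.dx x := by
    have h := Lp.coeFn_star u.dx
    rw [star_dx] at h
    exact h.mono fun x hx => hx.symm
  have hp (f : L2C) (hf : ∀ᵐ x, star (f x) = f x) (n : ℕ) :
      hatL1 (fun x => f x ^ n) (-ξ) = star (hatL1 (fun x => f x ^ n) ξ) :=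
    hatL1_neg_of_real (hf.mono fun x hx => by rw [star_pow, hx]) ξ
  rw [Coeffs.nonlinHat, Coeffs.nonlinHat, hp _ hu, hp _ hd, hp _ hu, p.tau_neg, p.psi_neg]
  simp
  ring

theorem exists_nonlin (hγ₁ : 0 < p.γ₁) (hδ₁ : 0 < p.δ₁) (u : GevreyH σ 2) :
    ∃ g : GevreyH σ 2, hat g.toL2 =ᵐ[volume] fun ξ => -Complex.I * p.nonlinHat u ξ := by
  refine exists_of_hat ?_ (Filter.Eventually.of_forall fun ξ => nonlinHat_neg u ξ)
  refine memLp_inv_bracket.of_le_mul (c := p.nonlinConst * (‖u‖ + ‖u‖ ^ 2) * ‖u‖) ?_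
    (Filter.Eventually.of_forall fun ξ => ?_)
  · have h1 := continuous_weight σ 2
    have h2 := continuous_nonlinHat hγ₁ hδ₁ u
    exact Continuous.aestronglyMeasurable (by fun_prop)
  · rw [norm_mul, norm_mul, norm_neg, Complex.norm_I, one_mul, norm_weight,
      Real.norm_of_nonneg (inv_nonneg.2 (bracket_pos ξ).le)]
    exact nonlinHat_bound hγ₁ hδ₁ u ξ

open Classical in
/-- The nonlinearity `-i F(u)`, as an element of `H^{σ,2}`. -/
def nonlin (p : Coeffs) (u : GevreyH σ 2) : GevreyH σ 2 :=
  if h : ∃ g : GevreyH σ 2, hat g.toL2 =ᵐ[volume] fun ξ => -Complex.I * p.nonlinHat u ξ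
  then h.choose else 0

theorem hat_nonlin (hγ₁ : 0 < p.γ₁) (hδ₁ : 0 < p.δ₁) (u : GevreyH σ 2) :
    hat (nonlin p u).toL2 =ᵐ[volume] fun ξ => -Complex.I * p.nonlinHat u ξ := by
  have h := exists_nonlin hγ₁ hδ₁ u
  rw [nonlin, dif_pos h]
  exact h.choose_spec

/-- The constant of the Lipschitz estimate for `nonlin`. -/
def lipConst (p : Coeffs) : ℝ := p.nonlinConst * (eLpNorm (fun ξ => (bracket ξ)⁻¹) 2 volume).toReal

theorem lipConst_nonneg (hδ₁ : 0 < p.δ₁) : 0 ≤ lipConst p :=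
  mul_nonneg (Coeffs.nonlinConst_pos hδ₁).le ENNReal.toReal_nonneg

theorem norm_nonlin_sub_le (hγ₁ : 0 < p.γ₁) (hδ₁ : 0 < p.δ₁) {u v : GevreyH σ 2} {r : ℝ}
    (hu : ‖u‖ ≤ r) (hv : ‖v‖ ≤ r) :
    ‖nonlin p u - nonlin p v‖ ≤ lipConst p * (r + r ^ 2) * ‖u - v‖ := by
  have hr : 0 ≤ r := (norm_nonneg u).trans hu
  have hK := (Coeffs.nonlinConst_pos hδ₁).le
  refine (norm_le_of_ae_le (C := p.nonlinConst * (r + r ^ 2) * ‖u - v‖) _ memLp_inv_bracket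
    (by positivity) ?_).trans_eq (by rw [lipConst]; ring)
  filter_upwards [hat_toL2_sub (nonlin p u) (nonlin p v), hat_nonlin hγ₁ hδ₁ u,
    hat_nonlin hγ₁ hδ₁ v] with ξ h1 h2 h3
  rw [h1, h2, h3, ← mul_sub, norm_mul, norm_neg, Complex.norm_I, one_mul,
    Real.norm_of_nonneg (inv_nonneg.2 (bracket_pos ξ).le)]
  exact nonlinHat_sub_bound hγ₁ hδ₁ hu hv ξ

theorem nonlin_zero (hγ₁ : 0 < p.γ₁) (hδ₁ : 0 < p.δ₁) : nonlin p (0 : GevreyH σ 2) = 0 := by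
  refine ext_hat ?_
  have h := hat_toL2_smul 0 (0 : GevreyH σ 2)
  rw [zero_smul] at h
  filter_upwards [hat_nonlin hγ₁ hδ₁ (0 : GevreyH σ 2), h] with ξ h1 h2
  rw [h1, h2, nonlinHat_zero]
  simp

/-! ### The isometric group `e^{-itφ(D)}`. -/

theorem norm_phase (t x : ℝ) : ‖Complex.exp (-Complex.I * t * x)‖ = 1 := by
  rw [Complex.norm_exp]
  simp

theorem exists_evolve (hγ₁ : 0 < p.γ₁) (hδ₁ : 0 < p.δ₁) (t : ℝ) (u : GevreyH σ 2) :
    ∃ g : GevreyH σ 2,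
      hat g.toL2 =ᵐ[volume] fun ξ => Complex.exp (-Complex.I * t * p.phi ξ) * hat u.toL2 ξ := by
  refine exists_of_hat ?_ ?_
  · have hc : Continuous fun ξ => Complex.exp (-Complex.I * t * p.phi ξ) := by
      have := Coeffs.continuous_phi hγ₁ hδ₁
      fun_prop
    refine MemLp.of_le u.memLp ?_ (Filter.Eventually.of_forall fun ξ => ?_)
    · refine (hc.aestronglyMeasurable.mul u.memLp.1).congr (Filter.Eventually.of_forall fun ξ => ?_)
      simp only [Pi.mul_apply, weightedHat]
      ring
    · rw [norm_mul, norm_mul, norm_phase, one_mul, weightedHat, norm_mul]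
  · filter_upwards [hat_neg u.toL2] with ξ h
    rw [h, p.phi_neg]
    simp [← Complex.exp_conj]

open Classical in
/-- The linear evolution `e^{-itφ(D)}` on `H^{σ,2}`. -/
def evolve (p : Coeffs) (t : ℝ) (u : GevreyH σ 2) : GevreyH σ 2 :=
  if h : ∃ g : GevreyH σ 2,
      hat g.toL2 =ᵐ[volume] fun ξ => Complex.exp (-Complex.I * t * p.phi ξ) * hat u.toL2 ξ
  then h.choose else 0

theorem hat_evolve (hγ₁ : 0 < p.γ₁) (hδ₁ : 0 < p.δ₁) (t : ℝ) (u : GevreyH σ 2) :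
    hat (evolve p t u).toL2 =ᵐ[volume]
      fun ξ => Complex.exp (-Complex.I * t * p.phi ξ) * hat u.toL2 ξ := by
  have h := exists_evolve hγ₁ hδ₁ t u
  rw [evolve, dif_pos h]
  exact h.choose_spec

theorem evolve_evolve (hγ₁ : 0 < p.γ₁) (hδ₁ : 0 < p.δ₁) (s t : ℝ) (u : GevreyH σ 2) :
    evolve p s (evolve p t u) = evolve p (s + t) u := by
  refine ext_hat ?_
  filter_upwards [hat_evolve hγ₁ hδ₁ s (evolve p t u), hat_evolve hγ₁ hδ₁ t u,
    hat_evolve hγ₁ hδ₁ (s + t) u] with ξ h1 h2 h3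
  rw [h1, h2, h3, ← mul_assoc, ← Complex.exp_add]
  congr 2
  push_cast
  ring

theorem evolve_zero_time (hγ₁ : 0 < p.γ₁) (hδ₁ : 0 < p.δ₁) (u : GevreyH σ 2) :
    evolve p 0 u = u := by
  refine ext_hat ?_
  filter_upwards [hat_evolve hγ₁ hδ₁ 0 u] with ξ h1
  simp [h1]

theorem evolve_sub (hγ₁ : 0 < p.γ₁) (hδ₁ : 0 < p.δ₁) (t : ℝ) (u v : GevreyH σ 2) :
    evolve p t (u - v) = evolve p t u - evolve p t v := by
  refine ext_hat ?_
  filter_upwards [hat_evolve hγ₁ hδ₁ t (u - v), hat_toL2_sub u v, hat_evolve hγ₁ hδ₁ t u,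
    hat_evolve hγ₁ hδ₁ t v, hat_toL2_sub (evolve p t u) (evolve p t v)] with ξ h1 h2 h3 h4 h5
  rw [h1, h2, h5, h3, h4, mul_sub]

theorem norm_eq_of_hat {u v : GevreyH σ 2} (h : ∀ᵐ ξ, ‖hat u.toL2 ξ‖ = ‖hat v.toL2 ξ‖) :
    ‖u‖ = ‖v‖ := by
  rw [norm_eq_weighted, norm_eq_weighted, Lp.norm_def, Lp.norm_def]
  congr 1
  refine eLpNorm_congr_norm_ae ?_
  filter_upwards [h, coeFn_weighted u, coeFn_weighted v] with ξ h1 h2 h3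
  rw [h2, h3, weightedHat, weightedHat, norm_mul, norm_mul, h1]

theorem norm_evolve (hγ₁ : 0 < p.γ₁) (hδ₁ : 0 < p.δ₁) (t : ℝ) (u : GevreyH σ 2) :
    ‖evolve p t u‖ = ‖u‖ := by
  refine norm_eq_of_hat ?_
  filter_upwards [hat_evolve hγ₁ hδ₁ t u] with ξ h
  rw [h, norm_mul, norm_phase, one_mul]

theorem norm_sq_eq_integral (u : GevreyH σ 2) :
    ‖u‖ ^ 2 = ∫ ξ, ‖weightedHat σ 2 u.toL2 ξ‖ ^ 2 := by
  have h := inner_self_eq_norm_sq (𝕜 := ℂ) (weighted σ 2 u)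
  rw [norm_eq_weighted, ← h, L2.inner_def]
  have h2 : ∫ ξ, inner ℂ (weighted σ 2 u ξ) (weighted σ 2 u ξ) =
      ∫ ξ, ((‖weightedHat σ 2 u.toL2 ξ‖ ^ 2 : ℝ) : ℂ) := by
    refine integral_congr_ae ?_
    filter_upwards [coeFn_weighted u] with ξ h1
    rw [h1, inner_self_eq_norm_sq_to_K]
    simp
  rw [h2, integral_complex_ofReal]
  simp

/-- Dominated convergence for the squared norm. Continuity is only strong, since the symbol grows
linearly when `δ₂ ≠ 0`. -/
theorem continuous_evolve_left (hγ₁ : 0 < p.γ₁) (hδ₁ : 0 < p.δ₁) (u : GevreyH σ 2) :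
    Continuous fun t => evolve p t u := by
  rw [continuous_iff_continuousAt]
  intro t₀
  rw [ContinuousAt, tendsto_iff_norm_sub_tendsto_zero]
  have hsq (t : ℝ) : ‖evolve p t u - evolve p t₀ u‖ ^ 2 =
      ∫ ξ, ‖(Complex.exp (-Complex.I * t * p.phi ξ) - Complex.exp (-Complex.I * t₀ * p.phi ξ)) *
        weightedHat σ 2 u.toL2 ξ‖ ^ 2 := by
    rw [norm_sq_eq_integral]
    refine integral_congr_ae ?_
    filter_upwards [hat_toL2_sub (evolve p t u) (evolve p t₀ u), hat_evolve hγ₁ hδ₁ t u,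
      hat_evolve hγ₁ hδ₁ t₀ u] with ξ h1 h2 h3
    rw [weightedHat, h1, h2, h3, weightedHat]
    congr 2
    ring
  have hφ := Coeffs.continuous_phi hγ₁ hδ₁
  have hcont : Continuous fun t : ℝ => ∫ ξ, ‖(Complex.exp (-Complex.I * t * p.phi ξ) -
      Complex.exp (-Complex.I * t₀ * p.phi ξ)) * weightedHat σ 2 u.toL2 ξ‖ ^ 2 := by
    refine continuous_of_dominated (bound := fun ξ => 4 * ‖weightedHat σ 2 u.toL2 ξ‖ ^ 2)
      (fun t => ?_) (fun t => Filter.Eventually.of_forall fun ξ => ?_) ?_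
      (Filter.Eventually.of_forall fun ξ => by fun_prop)
    · have : Continuous fun ξ => Complex.exp (-Complex.I * t * p.phi ξ) -
        Complex.exp (-Complex.I * t₀ * p.phi ξ) := by fun_prop
      exact (this.aestronglyMeasurable.mul u.memLp.1).norm.pow 2
    · rw [norm_mul, mul_pow, Real.norm_of_nonneg (by positivity)]
      gcongr
      have := norm_sub_le (Complex.exp (-Complex.I * t * p.phi ξ))
        (Complex.exp (-Complex.I * t₀ * p.phi ξ))
      rw [norm_phase, norm_phase] at this
      nlinarith [norm_nonneg (Complex.exp (-Complex.I * t * p.phi ξ) -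
        Complex.exp (-Complex.I * t₀ * p.phi ξ))]
    · exact ((memLp_two_iff_integrable_sq_norm u.memLp.1).1 u.memLp).const_mul 4
  have h0 := hcont.tendsto t₀
  simp only [← hsq] at h0
  have h1 := h0.sqrt
  simpa [Real.sqrt_sq (norm_nonneg _)] using h1

theorem continuous_evolve (hγ₁ : 0 < p.γ₁) (hδ₁ : 0 < p.δ₁) :
    Continuous fun q : ℝ × GevreyH σ 2 => evolve p q.1 q.2 := by
  refine continuous_prod_of_continuous_lipschitzWith' _ 1 (fun t => ?_)
    fun u => continuous_evolve_left hγ₁ hδ₁ u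
  refine LipschitzWith.of_dist_le_mul fun u v => ?_
  rw [dist_eq_norm, dist_eq_norm, ← evolve_sub hγ₁ hδ₁, norm_evolve hγ₁ hδ₁, NNReal.coe_one,
    one_mul]

end GevreyH


/-! ### Differential equations in a Banach space with a locally Lipschitz field. -/

section ODE

variable {E : Type*} [NormedAddCommGroup E]
  {f : ℝ → E → E} {K : ℝ}

theorem lipschitzOnWith_closedBall
    (hL : ∀ t r x y, ‖x‖ ≤ r → ‖y‖ ≤ r → ‖f t x - f t y‖ ≤ K * (r + r ^ 2) * ‖x - y‖) (t r : ℝ) :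
    LipschitzOnWith (K * (r + r ^ 2)).toNNReal (f t) (Metric.closedBall 0 r) := by
  refine LipschitzOnWith.of_dist_le_mul fun x hx y hy => ?_
  rw [mem_closedBall_zero_iff] at hx hy
  rw [dist_eq_norm, dist_eq_norm]
  refine (hL t r x y hx hy).trans ?_
  gcongr
  exact Real.le_coe_toNNReal _

theorem continuousOn_uncurry_closedBall
    (hL : ∀ t r x y, ‖x‖ ≤ r → ‖y‖ ≤ r → ‖f t x - f t y‖ ≤ K * (r + r ^ 2) * ‖x - y‖)
    (hc : ∀ x, Continuous (f · x)) (s : Set ℝ) (r : ℝ) :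
    ContinuousOn (Function.uncurry f) (s ×ˢ Metric.closedBall 0 r) :=
  continuousOn_prod_of_continuousOn_lipschitzOnWith' _ (K * (r + r ^ 2)).toNNReal
    (fun t _ => lipschitzOnWith_closedBall hL t r) fun x _ => (hc x).continuousOn

theorem exists_norm_le_of_continuousOn {v : ℝ → E} {T : ℝ} (hv : ContinuousOn v (Icc 0 T)) :
    ∃ r, ∀ t ∈ Icc 0 T, v t ∈ Metric.closedBall 0 r := by
  obtain ⟨r, hr⟩ := isCompact_Icc.exists_bound_of_continuousOn hv
  exact ⟨r, fun t ht => mem_closedBall_zero_iff.2 (hr t ht)⟩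

variable [NormedSpace ℝ E] [CompleteSpace E]

theorem hasDerivWithinAt_of_integral_eq
    (hL : ∀ t r x y, ‖x‖ ≤ r → ‖y‖ ≤ r → ‖f t x - f t y‖ ≤ K * (r + r ^ 2) * ‖x - y‖)
    (hc : ∀ x, Continuous (f · x)) {v : ℝ → E} {T : ℝ} {x : E} (hT : 0 ≤ T)
    (hv : ContinuousOn v (Icc 0 T))
    (h : ∀ t ∈ Icc 0 T, v t = x + ∫ s in (0 : ℝ)..t, f s (v s)) (t : ℝ) (ht : t ∈ Icc 0 T) :
    HasDerivWithinAt v (f t (v t)) (Icc 0 T) t := by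
  obtain ⟨r, hr⟩ := exists_norm_le_of_continuousOn hv
  exact (ODE.hasDerivWithinAt_picard_Icc ⟨le_rfl, hT⟩
    (continuousOn_uncurry_closedBall hL hc (Icc 0 T) r) hv hr x ht).congr_of_mem
      (fun t ht => h t ht) ht

/-- Continuous curves on `[0, T]` are bounded, so both stay in one ball, where the field is
Lipschitz and Grönwall applies. No smallness of the curves or of `T` is needed. -/
theorem eqOn_of_integral_eq
    (hL : ∀ t r x y, ‖x‖ ≤ r → ‖y‖ ≤ r → ‖f t x - f t y‖ ≤ K * (r + r ^ 2) * ‖x - y‖)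
    (hc : ∀ x, Continuous (f · x)) {v w : ℝ → E} {T : ℝ} {x : E} (hT : 0 ≤ T)
    (hv : ContinuousOn v (Icc 0 T)) (hw : ContinuousOn w (Icc 0 T))
    (h : ∀ t ∈ Icc 0 T, v t = x + ∫ s in (0 : ℝ)..t, f s (v s))
    (h' : ∀ t ∈ Icc 0 T, w t = x + ∫ s in (0 : ℝ)..t, f s (w s)) : EqOn v w (Icc 0 T) := by
  obtain ⟨r₁, hr₁⟩ := exists_norm_le_of_continuousOn hv
  obtain ⟨r₂, hr₂⟩ := exists_norm_le_of_continuousOn hw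
  have h0 : (0 : ℝ) ∈ Icc 0 T := ⟨le_rfl, hT⟩
  have hd {z : ℝ → E} (hz : ContinuousOn z (Icc 0 T))
      (hz' : ∀ t ∈ Icc 0 T, z t = x + ∫ s in (0 : ℝ)..t, f s (z s)) (t : ℝ) (ht : t ∈ Ico 0 T) :
      HasDerivWithinAt z (f t (z t)) (Ici t) t :=
    (hasDerivWithinAt_of_integral_eq hL hc hT hz hz' t (Ico_subset_Icc_self ht)).mono_of_mem_nhdsWithin
      (Icc_mem_nhdsGE_of_mem ht)
  refine ODE_solution_unique_of_mem_Icc_right (v := f)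
    (s := fun _ => Metric.closedBall 0 (max r₁ r₂))
    (fun t _ => lipschitzOnWith_closedBall hL t _) hv (hd hv h)
    (fun t ht => Metric.closedBall_subset_closedBall (le_max_left _ _)
      (hr₁ t (Ico_subset_Icc_self ht))) hw (hd hw h')
    (fun t ht => Metric.closedBall_subset_closedBall (le_max_right _ _)
      (hr₂ t (Ico_subset_Icc_self ht))) ?_
  rw [h 0 h0, h' 0 h0]
  simp

/-- Picard-Lindelöf centred at `0`, not at a datum: one application covers the whole ball of radius
`R` and gives Lipschitz dependence there. As `f t 0 = 0`, the speed in the ball of radius `2R` is at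
most `K (2R + 4R²) 2R`. -/
theorem exists_flow
    (hL : ∀ t r x y, ‖x‖ ≤ r → ‖y‖ ≤ r → ‖f t x - f t y‖ ≤ K * (r + r ^ 2) * ‖x - y‖)
    (hf0 : ∀ t, f t 0 = 0) (hc : ∀ x, Continuous (f · x)) (hK : 0 ≤ K) {R T : ℝ} (hR : 1 ≤ R)
    (hT : 0 ≤ T) (hRT : 12 * K * R ^ 2 * T ≤ 1) :
    ∃ α : E → ℝ → E, (∀ x ∈ Metric.closedBall (0 : E) R, ContinuousOn (α x) (Icc 0 T) ∧
      ∀ t ∈ Icc 0 T, α x t = x + ∫ s in (0 : ℝ)..t, f s (α x s)) ∧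
      ∃ L : NNReal, ∀ t ∈ Icc 0 T, LipschitzOnWith L (α · t) (Metric.closedBall 0 R) := by
  have hR0 : 0 ≤ R := zero_le_one.trans hR
  have hPL : IsPicardLindelof f (tmin := 0) (tmax := T) ⟨0, le_rfl, hT⟩ 0
      (⟨2 * R, by positivity⟩ : NNReal) ⟨R, hR0⟩
      ⟨K * (2 * R + (2 * R) ^ 2) * (2 * R), by positivity⟩
      (K * (2 * R + (2 * R) ^ 2)).toNNReal := by
    refine ⟨fun t _ => lipschitzOnWith_closedBall hL t _, fun x _ => (hc x).continuousOn,
      fun t _ x hx => ?_, ?_⟩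
    · rw [mem_closedBall_zero_iff] at hx
      have h := hL t (2 * R) x 0 hx (by rw [norm_zero]; positivity)
      rw [hf0, sub_zero, sub_zero] at h
      refine h.trans ?_
      change _ ≤ K * (2 * R + (2 * R) ^ 2) * (2 * R)
      gcongr
      exact hx
    -- A trajectory must not travel further than `2R - R`; this follows from `4R + 8R² ≤ 12R²`,
    -- which is where `R ≥ 1` and the 12 come from.
    · change K * (2 * R + (2 * R) ^ 2) * (2 * R) * max (T - 0) (0 - 0) ≤ 2 * R - R
      rw [sub_zero, sub_zero, max_eq_left hT]
      have h1 : K * (2 * R + (2 * R) ^ 2) * (2 * R) * T = R * (K * T * (4 * R + 8 * R ^ 2)) := by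
        ring
      have h2 : K * T * (4 * R + 8 * R ^ 2) ≤ K * T * (12 * R ^ 2) := by
        have := mul_nonneg hK hT
        gcongr
        nlinarith
      rw [h1]
      nlinarith
  obtain ⟨α, hα, L, hLip⟩ := hPL.exists_forall_mem_closedBall_eq_hasDerivWithinAt_lipschitzOnWith
  refine ⟨α, fun x hx => ?_, L, hLip⟩
  obtain ⟨h0, hd⟩ := hα x hx
  have hcont : ContinuousOn (α x) (Icc 0 T) := HasDerivWithinAt.continuousOn hd
  refine ⟨hcont, fun t ht => ?_⟩
  obtain ⟨r, hr⟩ := exists_norm_le_of_continuousOn hcont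
  have hsub : uIcc 0 t ⊆ Icc 0 T := uIcc_subset_Icc ⟨le_rfl, hT⟩ ht
  have h := ODE.picard_eq_of_hasDerivAt (continuousOn_uncurry_closedBall hL hc (uIcc 0 t) r)
    (fun s hs => (hd s (hsub hs)).mono hsub) (fun s hs => hr s (hsub hs))
  rw [← h, ODE.picard_apply]
  change α x 0 = x at h0
  rw [h0]

end ODE

/-! ### Mild solutions as solutions of the interaction-picture equation. -/

namespace GevreyH

variable {σ : ℝ} {p : Coeffs}

/-- A test functional `f ↦ ∫ φ f̂` is continuous on `H^{σ,2}`. -/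
theorem exists_testFunctional (σ : ℝ) (φ : SchwartzMap ℝ ℂ) :
    ∃ ℓ : GevreyH σ 2 →L[ℝ] ℂ, ∀ f, ℓ f = ∫ ξ, φ ξ * hat f.toL2 ξ := by
  have hm : MemLp (fun ξ => ((weight σ 2 ξ)⁻¹ : ℝ) * φ ξ) 2 volume := by
    refine (φ.memLp 2 volume).of_le ?_ (Filter.Eventually.of_forall fun ξ => ?_)
    · have h1 : Continuous fun ξ => (weight σ 2 ξ)⁻¹ :=
        (continuous_weight σ 2).inv₀ fun ξ => (weight_pos _ _ _).ne'
      have h2 := φ.continuous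
      exact Continuous.aestronglyMeasurable (by fun_prop)
    · rw [norm_mul, Complex.norm_real, Real.norm_of_nonneg (inv_nonneg.2 (weight_pos _ _ _).le)]
      exact mul_le_of_le_one_left (norm_nonneg _) (inv_le_one_of_one_le₀ (one_le_weight _ _))
  let W : GevreyH σ 2 →L[ℝ] L2C := ⟨weighted σ 2, (isometry_weighted 2).continuous⟩
  refine ⟨((ContinuousLinearMap.mul ℝ ℂ).lpPairing volume 2 2 (hm.toLp _)).comp W, fun f => ?_⟩
  rw [ContinuousLinearMap.comp_apply, ContinuousLinearMap.lpPairing_eq_integral]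
  refine integral_congr_ae ?_
  filter_upwards [hm.coeFn_toLp, coeFn_weighted f] with ξ h1 h2
  change (hm.toLp _ : L2C) ξ * weighted σ 2 f ξ = _
  rw [h1, h2, weightedHat]
  have h3 : (weight σ 2 ξ : ℂ) ≠ 0 := by exact_mod_cast (weight_pos σ 2 ξ).ne'
  push_cast
  field_simp

theorem locallyIntegrable_hat (f : GevreyH σ 2) : LocallyIntegrable (hat f.toL2) := by
  refine (memLp_comp_mul (V := (𝓕 f.toC : L2C)) (a := (2 * Real.pi)⁻¹) (by positivity)
    (Lp.memLp _)).locallyIntegrable (by norm_num)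

/-- Bochner integrals in `H^{σ,2}` are computed pointwise on the Fourier side. -/
theorem hat_integral {g : ℝ → GevreyH σ 2} {h : ℝ → ℝ → ℂ} {a b M : ℝ} (hg : Continuous g)
    (hh : Continuous (Function.uncurry h)) (hM : ∀ s ξ, ‖h s ξ‖ ≤ M)
    (hgh : ∀ s, hat (g s).toL2 =ᵐ[volume] h s) :
    hat (∫ s in a..b, g s).toL2 =ᵐ[volume] fun ξ => ∫ s in a..b, h s ξ := by
  have hcont : Continuous fun ξ => ∫ s in a..b, h s ξ :=
    intervalIntegral.continuous_parametric_intervalIntegral_of_continuous' (f := fun ξ s => h s ξ)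
      (hh.comp continuous_swap) a b
  refine ae_eq_of_forall_schwartz (locallyIntegrable_hat _) hcont.locallyIntegrable fun φ => ?_
  -- Testing against a Schwartz function is a continuous functional, so it passes through the
  -- Bochner integral; Fubini, justified by the bound `M`, then exchanges time and frequency.
  obtain ⟨ℓ, hℓ⟩ := exists_testFunctional σ φ
  rw [← hℓ, ← ℓ.intervalIntegral_comp_comm (hg.intervalIntegrable a b)]
  have h1 (s : ℝ) : ℓ (g s) = ∫ ξ, φ ξ * h s ξ := by
    rw [hℓ]
    refine integral_congr_ae ?_
    filter_upwards [hgh s] with ξ hξ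
    rw [hξ]
  simp only [h1]
  have hint : Integrable (Function.uncurry fun s ξ => φ ξ * h s ξ)
      ((volume.restrict (uIoc a b)).prod volume) := by
    have hφ : Integrable (fun q : ℝ × ℝ => M * ‖φ q.2‖)
        ((volume.restrict (uIoc a b)).prod volume) := by
      have : IsFiniteMeasure ((volume : Measure ℝ).restrict (uIoc a b)) :=
        ⟨by simp [uIoc, Real.volume_Ioc]⟩
      exact (φ.integrable.norm.comp_snd _).const_mul M
    refine hφ.mono' ?_ (Filter.Eventually.of_forall fun q => ?_)
    · have := φ.continuous
      exact ((this.comp continuous_snd).mul hh).aestronglyMeasurable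
    · simp only [Function.uncurry, norm_mul]
      rw [mul_comm]
      gcongr
      exact hM _ _
  rw [MeasureTheory.intervalIntegral_integral_swap hint]
  refine integral_congr_ae (Filter.Eventually.of_forall fun ξ => ?_)
  exact intervalIntegral.integral_const_mul _ _

theorem norm_nonlinHat_sub_le (hγ₁ : 0 < p.γ₁) (hδ₁ : 0 < p.δ₁) {u v : GevreyH σ 2} {r : ℝ}
    (hu : ‖u‖ ≤ r) (hv : ‖v‖ ≤ r) (ξ : ℝ) :
    ‖p.nonlinHat u ξ - p.nonlinHat v ξ‖ ≤ p.nonlinConst * (r + r ^ 2) * ‖u - v‖ := by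
  have hr : 0 ≤ r := (norm_nonneg u).trans hu
  have hK := (Coeffs.nonlinConst_pos hδ₁).le
  refine (le_mul_of_one_le_left (norm_nonneg _) (one_le_weight σ ξ)).trans
    ((nonlinHat_sub_bound hγ₁ hδ₁ hu hv ξ).trans ?_)
  exact mul_le_of_le_one_right (by positivity) (inv_le_one_of_one_le₀ (one_le_bracket ξ))

/-- Continuity in `s` is uniform in `ξ` by the Lipschitz bound, so separate continuity is enough. -/
theorem continuous_nonlinHat_uncurry (hγ₁ : 0 < p.γ₁) (hδ₁ : 0 < p.δ₁) {u : ℝ → GevreyH σ 2}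
    (hu : Continuous u) {r : ℝ} (hr : ∀ s, ‖u s‖ ≤ r) :
    Continuous fun q : ℝ × ℝ => p.nonlinHat (u q.1) q.2 := by
  rw [continuous_iff_continuousAt]
  rintro ⟨s₀, ξ₀⟩
  have h1 : Filter.Tendsto (fun q : ℝ × ℝ => p.nonlinHat (u q.1) q.2 - p.nonlinHat (u s₀) q.2)
      (nhds (s₀, ξ₀)) (nhds 0) := by
    refine squeeze_zero_norm (fun q => norm_nonlinHat_sub_le hγ₁ hδ₁ (hr q.1) (hr s₀) q.2) ?_
    have hc : Continuous fun q : ℝ × ℝ => p.nonlinConst * (r + r ^ 2) * ‖u q.1 - u s₀‖ := by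
      fun_prop
    simpa using hc.tendsto (s₀, ξ₀)
  have h2 : Filter.Tendsto (fun q : ℝ × ℝ => p.nonlinHat (u s₀) q.2)
      (nhds (s₀, ξ₀)) (nhds (p.nonlinHat (u s₀) ξ₀)) :=
    ((continuous_nonlinHat hγ₁ hδ₁ (u s₀)).comp continuous_snd).tendsto (s₀, ξ₀)
  have h3 := h1.add h2
  simpa [ContinuousAt] using h3

theorem continuous_nonlin (hγ₁ : 0 < p.γ₁) (hδ₁ : 0 < p.δ₁) :
    Continuous (nonlin p : GevreyH σ 2 → GevreyH σ 2) := by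
  rw [continuous_iff_continuousAt]
  intro u
  refine LipschitzOnWith.continuousOn (K := (lipConst p * ((‖u‖ + 1) + (‖u‖ + 1) ^ 2)).toNNReal)
    (s := Metric.closedBall 0 (‖u‖ + 1)) ?_ |>.continuousAt ?_
  · exact lipschitzOnWith_closedBall (f := fun _ => nonlin p)
      (fun _ r x y hx hy => norm_nonlin_sub_le hγ₁ hδ₁ hx hy) 0 _
  · refine Metric.isOpen_ball.mem_nhds ?_ |> Filter.mem_of_superset <| Metric.ball_subset_closedBall
    simp

theorem continuous_evolve_comp (hγ₁ : 0 < p.γ₁) (hδ₁ : 0 < p.δ₁) {X : Type*} [TopologicalSpace X]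
    {t : X → ℝ} {u : X → GevreyH σ 2} (ht : Continuous t) (hu : Continuous u) :
    Continuous fun x => evolve p (t x) (u x) := by
  have hc : Continuous fun q : ℝ × GevreyH σ 2 => evolve p q.1 q.2 := continuous_evolve hγ₁ hδ₁
  exact hc.comp₂ ht hu

/-- The nonlinearity in the interaction picture. -/
def vectorField (p : Coeffs) (t : ℝ) (x : GevreyH σ 2) : GevreyH σ 2 :=
  evolve p (-t) (nonlin p (evolve p t x))

/-- The evolution is an isometry, so the bound for `nonlin` carries over uniformly in `t`. The `+ 1`
only makes the constant positive, so that it can be inverted to define `c`. -/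
theorem norm_vectorField_sub_le (hγ₁ : 0 < p.γ₁) (hδ₁ : 0 < p.δ₁) (t r : ℝ) (x y : GevreyH σ 2)
    (hx : ‖x‖ ≤ r) (hy : ‖y‖ ≤ r) :
    ‖vectorField p t x - vectorField p t y‖ ≤ (lipConst p + 1) * (r + r ^ 2) * ‖x - y‖ := by
  have hr : 0 ≤ r := (norm_nonneg x).trans hx
  rw [vectorField, vectorField, ← evolve_sub hγ₁ hδ₁, norm_evolve hγ₁ hδ₁]
  refine (norm_nonlin_sub_le (r := r) hγ₁ hδ₁ (by rwa [norm_evolve hγ₁ hδ₁])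
    (by rwa [norm_evolve hγ₁ hδ₁])).trans ?_
  rw [← evolve_sub hγ₁ hδ₁, norm_evolve hγ₁ hδ₁]
  gcongr
  linarith

theorem evolve_zero (hγ₁ : 0 < p.γ₁) (hδ₁ : 0 < p.δ₁) (t : ℝ) :
    evolve p t (0 : GevreyH σ 2) = 0 :=
  norm_eq_zero.1 (by rw [norm_evolve hγ₁ hδ₁, norm_zero])

theorem vectorField_zero (hγ₁ : 0 < p.γ₁) (hδ₁ : 0 < p.δ₁) (t : ℝ) :
    vectorField p t (0 : GevreyH σ 2) = 0 := by
  rw [vectorField, evolve_zero hγ₁ hδ₁, nonlin_zero hγ₁ hδ₁, evolve_zero hγ₁ hδ₁]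

theorem continuous_vectorField (hγ₁ : 0 < p.γ₁) (hδ₁ : 0 < p.δ₁) (x : GevreyH σ 2) :
    Continuous (vectorField p · x) :=
  continuous_evolve_comp hγ₁ hδ₁ continuous_neg
    ((continuous_nonlin hγ₁ hδ₁).comp (continuous_evolve_left hγ₁ hδ₁ x))

/-- The phase `e^{-i(t-s)φ}` splits into `e^{-itφ} e^{isφ}`, and the first factor is invertible.
Only times in `[0, t]` enter, so the zero extension can be replaced by the continuous `IccExtend`.
-/
theorem isMildSolution_iff (hγ₁ : 0 < p.γ₁) (hδ₁ : 0 < p.δ₁) {T : ℝ} (hT : 0 ≤ T)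
    (u₀ : GevreyH σ 2) (η : C(Icc (0 : ℝ) T, GevreyH σ 2)) :
    IsMildSolution p u₀ η ↔ ∀ t ∈ Icc 0 T, evolve p (-t) (IccExtend hT η t) =
      u₀ + ∫ s in (0 : ℝ)..t, vectorField p s (evolve p (-s) (IccExtend hT η s)) := by
  have hη : Continuous (IccExtend hT η) := η.continuous.Icc_extend'
  have hr (s : ℝ) : ‖IccExtend hT η s‖ ≤ ‖η‖ := η.norm_coe_le_norm _
  have hV (s : ℝ) : vectorField p s (evolve p (-s) (IccExtend hT η s)) =
      evolve p (-s) (nonlin p (IccExtend hT η s)) := by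
    rw [vectorField, evolve_evolve hγ₁ hδ₁, add_neg_cancel, evolve_zero_time hγ₁ hδ₁]
  simp only [hV]
  have hφ := Coeffs.continuous_phi hγ₁ hδ₁
  have hint (t : ℝ) : hat (∫ s in (0 : ℝ)..t, evolve p (-s) (nonlin p (IccExtend hT η s))).toL2
      =ᵐ[volume] fun ξ => ∫ s in (0 : ℝ)..t, Complex.exp (-Complex.I * (-s : ℝ) * p.phi ξ) *
        (-Complex.I * p.nonlinHat (IccExtend hT η s) ξ) := by
    refine hat_integral (M := p.nonlinConst * (‖η‖ + ‖η‖ ^ 2) * ‖η‖) ?_ ?_ ?_ ?_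
    · exact continuous_evolve_comp hγ₁ hδ₁ continuous_neg ((continuous_nonlin hγ₁ hδ₁).comp hη)
    · have h1 := continuous_nonlinHat_uncurry hγ₁ hδ₁ hη hr
      simp only [Function.uncurry_def]
      fun_prop
    · intro s ξ
      rw [norm_mul, norm_phase, one_mul, norm_mul, norm_neg, Complex.norm_I, one_mul]
      have h1 := norm_nonlinHat_sub_le hγ₁ hδ₁ (v := 0) (hr s) (by simp) ξ
      rw [nonlinHat_zero, sub_zero, sub_zero] at h1
      have hK := (Coeffs.nonlinConst_pos hδ₁).le
      refine h1.trans ?_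
      gcongr
      exact hr s
    · intro s
      filter_upwards [hat_evolve hγ₁ hδ₁ (-s) (nonlin p (IccExtend hT η s)),
        hat_nonlin hγ₁ hδ₁ (IccExtend hT η s)] with ξ h1 h2
      rw [h1, h2]
  have hduh (t : ℝ) (ht : t ∈ Icc 0 T) (ξ : ℝ) :
      Complex.I * ∫ s in (0 : ℝ)..t, Complex.exp (-Complex.I * ((t : ℝ) - s) * p.phi ξ) *
        p.nonlinHat (extendZero η s) ξ =
      -(Complex.exp (-Complex.I * t * p.phi ξ) * ∫ s in (0 : ℝ)..t,
        Complex.exp (-Complex.I * (-s : ℝ) * p.phi ξ) *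
        (-Complex.I * p.nonlinHat (IccExtend hT η s) ξ)) := by
    rw [← intervalIntegral.integral_const_mul, ← intervalIntegral.integral_const_mul,
      ← intervalIntegral.integral_neg]
    refine intervalIntegral.integral_congr fun s hs => ?_
    rw [uIcc_of_le ht.1] at hs
    have hs' : s ∈ Icc 0 T := ⟨hs.1, hs.2.trans ht.2⟩
    have he : extendZero η s = IccExtend hT η s := by
      rw [extendZero, dif_pos hs', IccExtend_of_mem hT _ hs']
    have hexp : Complex.exp (-Complex.I * ((t : ℝ) - s) * p.phi ξ) =
        Complex.exp (-Complex.I * t * p.phi ξ) *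
          Complex.exp (-Complex.I * (-s : ℝ) * p.phi ξ) := by
      rw [← Complex.exp_add]
      congr 1
      push_cast
      ring
    simp only [he, hexp]
    ring
  have hcancel (t ξ : ℝ) : Complex.exp (-Complex.I * t * p.phi ξ) *
      Complex.exp (-Complex.I * (-t : ℝ) * p.phi ξ) = 1 := by
    rw [← Complex.exp_add, ← Complex.exp_zero]
    congr 1
    push_cast
    ring
  constructor
  · intro h t ht
    refine ext_hat ?_
    filter_upwards [h ⟨t, ht⟩, hat_evolve hγ₁ hδ₁ (-t) (IccExtend hT η t), hint t,
      hat_toL2_add u₀ (∫ s in (0 : ℝ)..t, evolve p (-s) (nonlin p (IccExtend hT η s)))]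
      with ξ h1 h2 h3 h4
    rw [h4, h3, h2, IccExtend_of_mem hT _ ht, h1]
    rw [hduh t ht]
    linear_combination (hat u₀.toL2 ξ + ∫ s in (0 : ℝ)..t,
      Complex.exp (-Complex.I * (-s : ℝ) * p.phi ξ) *
        (-Complex.I * p.nonlinHat (IccExtend hT η s) ξ)) * hcancel t ξ
  · rintro h ⟨t, ht⟩
    have h0 := h t ht
    filter_upwards [hat_evolve hγ₁ hδ₁ (-t) (IccExtend hT η t), hint t,
      hat_toL2_add u₀ (∫ s in (0 : ℝ)..t, evolve p (-s) (nonlin p (IccExtend hT η s)))]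
      with ξ h2 h3 h4
    rw [← h0, h3, h2, IccExtend_of_mem hT _ ht] at h4
    rw [hduh t ht]
    linear_combination (Complex.exp (-Complex.I * t * p.phi ξ)) * h4 -
      hat (η ⟨t, ht⟩).toL2 ξ * hcancel t ξ

/-- Undo the interaction picture: the evolution is isometric at each time, so the Lipschitz constant
of the flow becomes one for the supremum norm. -/
theorem exists_solutionMap (hγ₁ : 0 < p.γ₁) (hδ₁ : 0 < p.δ₁) {R T : ℝ} (hR : 1 ≤ R) (hT : 0 ≤ T)
    (hRT : 12 * (lipConst p + 1) * R ^ 2 * T ≤ 1) :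
    ∃ Φ : GevreyH σ 2 → C(Icc (0 : ℝ) T, GevreyH σ 2),
      ContinuousOn Φ (Metric.closedBall 0 R) ∧
      ∀ u₀ ∈ Metric.closedBall (0 : GevreyH σ 2) R, ∀ η : C(Icc (0 : ℝ) T, GevreyH σ 2),
        IsMildSolution p u₀ η ↔ η = Φ u₀ := by
  classical
  obtain ⟨α, hα, L, hLip⟩ := exists_flow (f := vectorField (σ := σ) p)
    (norm_vectorField_sub_le hγ₁ hδ₁) (vectorField_zero hγ₁ hδ₁)
    (continuous_vectorField hγ₁ hδ₁) (by linarith [lipConst_nonneg (p := p) hδ₁]) hR hT hRT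
  have hcont (x : GevreyH σ 2) (hx : x ∈ Metric.closedBall (0 : GevreyH σ 2) R) :
      Continuous fun t : Icc (0 : ℝ) T => evolve p t (α x t) :=
    continuous_evolve_comp hγ₁ hδ₁ continuous_subtype_val
      (continuousOn_iff_continuous_domRestrict.1 (hα x hx).1)
  let Φ : GevreyH σ 2 → C(Icc (0 : ℝ) T, GevreyH σ 2) := fun x =>
    if hx : x ∈ Metric.closedBall (0 : GevreyH σ 2) R then ⟨_, hcont x hx⟩ else 0
  have hΦ (x : GevreyH σ 2) (hx : x ∈ Metric.closedBall (0 : GevreyH σ 2) R)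
      (t : Icc (0 : ℝ) T) : Φ x t = evolve p t (α x t) := by
    simp only [Φ, dif_pos hx]
    rfl
  have hΦ' (x : GevreyH σ 2) (hx : x ∈ Metric.closedBall (0 : GevreyH σ 2) R) (t : ℝ)
      (ht : t ∈ Icc 0 T) : evolve p (-t) (IccExtend hT (Φ x) t) = α x t := by
    rw [IccExtend_of_mem hT _ ht, hΦ x hx, evolve_evolve hγ₁ hδ₁, neg_add_cancel,
      evolve_zero_time hγ₁ hδ₁]
  have hsol (x : GevreyH σ 2) (hx : x ∈ Metric.closedBall (0 : GevreyH σ 2) R) :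
      IsMildSolution p x (Φ x) := by
    rw [isMildSolution_iff hγ₁ hδ₁ hT]
    intro t ht
    rw [hΦ' x hx t ht, (hα x hx).2 t ht]
    congr 1
    refine intervalIntegral.integral_congr fun s hs => ?_
    simp only [hΦ' x hx s (uIcc_subset_Icc ⟨le_rfl, hT⟩ ht hs)]
  refine ⟨Φ, ?_, fun u₀ hu₀ η => ⟨fun h => ?_, fun h => h ▸ hsol u₀ hu₀⟩⟩
  · refine LipschitzOnWith.continuousOn (K := L) (LipschitzOnWith.of_dist_le_mul
      fun x hx y hy => ?_)
    rw [ContinuousMap.dist_le (by positivity)]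
    intro t
    rw [hΦ x hx, hΦ y hy, dist_eq_norm, ← evolve_sub hγ₁ hδ₁, norm_evolve hγ₁ hδ₁, ← dist_eq_norm]
    exact (hLip t t.2).dist_le_mul x hx y hy
  · have hc (ζ : C(Icc (0 : ℝ) T, GevreyH σ 2)) :
        ContinuousOn (fun t => evolve p (-t) (IccExtend hT ζ t)) (Icc 0 T) :=
      (continuous_evolve_comp hγ₁ hδ₁ continuous_neg ζ.continuous.Icc_extend').continuousOn
    have heq := eqOn_of_integral_eq (norm_vectorField_sub_le hγ₁ hδ₁)
      (continuous_vectorField hγ₁ hδ₁) hT (hc η) (hc (Φ u₀))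
      ((isMildSolution_iff hγ₁ hδ₁ hT u₀ η).1 h)
      ((isMildSolution_iff hγ₁ hδ₁ hT u₀ (Φ u₀)).1 (hsol u₀ hu₀))
    ext1 t
    have h1 := congrArg (evolve p t) (heq t.2)
    simpa only [evolve_evolve hγ₁ hδ₁, add_neg_cancel, evolve_zero_time hγ₁ hδ₁,
      IccExtend_val] using h1

end GevreyH

end KdVBBM

end

theorem theorem2 (p : KdVBBM.Coeffs) (hγ₁ : 0 < p.γ₁) (hδ₁ : 0 < p.δ₁) :
    ∃ c : ℝ, 0 < c ∧
      ∀ (σ₀ : ℝ), 0 < σ₀ → ∀ (η₀ : KdVBBM.GevreyH σ₀ 2) (T : ℝ),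
        T = c * ((1 + ‖η₀‖) ^ 2)⁻¹ →
        (∃! η : C(Set.Icc (0 : ℝ) T, KdVBBM.GevreyH σ₀ 2), KdVBBM.IsMildSolution p η₀ η) ∧
        ∃ U : Set (KdVBBM.GevreyH σ₀ 2), IsOpen U ∧ Metric.closedBall 0 ‖η₀‖ ⊆ U ∧
          ∃ Φ : KdVBBM.GevreyH σ₀ 2 → C(Set.Icc (0 : ℝ) T, KdVBBM.GevreyH σ₀ 2),
            ContinuousOn Φ U ∧
            ∀ u₀ ∈ U, ∀ η : C(Set.Icc (0 : ℝ) T, KdVBBM.GevreyH σ₀ 2),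
              KdVBBM.IsMildSolution p u₀ η ↔ η = Φ u₀ := by
  have hK : 0 < KdVBBM.GevreyH.lipConst p + 1 := by
    linarith [KdVBBM.GevreyH.lipConst_nonneg (p := p) hδ₁]
  -- This `c` gives equality in the smallness condition for `R = 1 + ‖η₀‖`. The extra 1 also makes
  -- the open ball of radius `R`, taken as `U`, contain the closed ball of radius `‖η₀‖`.
  refine ⟨(12 * (KdVBBM.GevreyH.lipConst p + 1))⁻¹, by positivity, fun σ₀ _ η₀ T hT => ?_⟩
  have hn := norm_nonneg η₀
  have hR : 1 ≤ 1 + ‖η₀‖ := by linarith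
  have hT0 : 0 ≤ T := by rw [hT]; positivity
  obtain ⟨Φ, hΦ, hsol⟩ := KdVBBM.GevreyH.exists_solutionMap (σ := σ₀) hγ₁ hδ₁ hR hT0 (by
    rw [hT]
    refine le_of_eq ?_
    field_simp)
  refine ⟨⟨Φ η₀, ?_, fun η hη => ?_⟩, Metric.ball 0 (1 + ‖η₀‖), Metric.isOpen_ball,
    Metric.closedBall_subset_ball (by linarith), Φ, hΦ.mono Metric.ball_subset_closedBall,
    fun u₀ hu₀ => hsol u₀ (Metric.ball_subset_closedBall hu₀)⟩
  · exact (hsol η₀ (by simp) _).2 rfl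
  · exact (hsol η₀ (by simp) _).1 hη
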